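/- Let $n \geq 1$ be an integer and let $S$ be a finite set. **Black graphs.** A (finite) graph $\Gamma$ consists of a finite set $V$ of vertices, a finite set $H$ of half-edges, a map $\partial \colon H \to V$ and an involution $\iota$ of $H$; its edges $E(\Gamma)$ are the free orbits of $\iota$ and its legs $L(\Gamma)$ are the fixed points of $\iota$. A black graph with legs $S$ is a connected non-empty graph with a weight $w(v) \in \{0,1,2,\ldots\}$ on each vertex and a bijection $\ell \colon L(\Gamma) \cong S$, which is admissible: $2w(v) + \mathrm{val}(v) \geq 3$ for all $v \in V$, where $\mathrm{val}(v) = \#\partial^{-1}(v)$. Its internal degree is $\deg_{\mathrm{int}}(\Gamma) = n\sum_{v \in V} (2w(v) + \mathrm{val}(v) - 2)$ and its total degree is $\deg_{\mathrm{int}}(\Gamma) + \#E(\Gamma)$. **The complexes.** Let $G^{E_n}(S)$ be the chain complex of rational vector spaces $$G^{E_n}(S) = \Big(\bigoplus_{(\Gamma,\ell)} \det(\mathbb{Q}^{E(\Gamma)}) \otimes \det(\mathbb{Q}^{L(\Gamma)})^{\otimes n}\Big)\Big/\sim,$$ where the sum is over all black graphs with legs $S$, the summand of $\Gamma$ is placed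 in the total degree of $\Gamma$, $\det$ is the top exterior power, and $\sim$ identifies the summands along isomorphisms of weighted graphs compatible with $\ell$. Its differential is $d(\Gamma, \ell, \nu, \omega^{\otimes n}) = \sum_{e \in E(\Gamma)} (\Gamma/e, \ell, \nu/e, \omega^{\otimes n})$, where $\nu/e$ is the contraction of $\nu$ with $e$, and $\Gamma/e$ is obtained by contracting $e = \{h_1,h_2\}$: the new vertex has weight $w(\partial h_1) + w(\partial h_2)$ if $\partial h_1 \neq \partial h_2$, and $w(\partial h_1) + 1$ if $e$ is a loop. Let $G^{Z_n}(S)$ be the quotient of $G^{E_n}(S)$ by the subcomplex spanned by the graphs having some vertex of positive weight. Both complexes split as direct sums of subcomplexes $G^{E_n}(S)_q$, $G^{Z_n}(S)_q$ according to the internal degree $q$. Write $H_{p+q}(G^{Z_n}(S), G^{E_n}(S))_q$ for the relative homology in total degree $p+q$ and internal degree $q$, i.e. the homology in degree $p+q$ of the mapping cone of the quotient map $G^{E_n}(S)_q \to G^{Z_n}(S)_q$. **Statement.** For all integers $p$ and $q$, $$H_{p+q}(G^{Z_n}(S), G^{E_n}(S))_q \cong \begin{cases} \mathbb{Q} & \text{if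 } |S| = 1 \text{ and } (p,q) = (1,n),\\ 0 & \text{otherwise.}\end{cases}$$ -/

import Mathlib

universe u

/-- A finite graph with a weight `wt v ∈ ℕ` on every vertex and with legs labelled by `S`:
vertices `V`, half-edges `H`, boundary map `bd`, involution `inv` on the half-edges; the legs are
the fixed points of `inv` and they are identified with `S` by `label`. -/
structure WGraph (S : Type u) : Type (u + 1) where
  V : Type u
  H : Type u
  [fintypeV : Fintype V]
  [fintypeH : Fintype H]
  bd : H → V
  inv : H → H
  inv_inv : ∀ h, inv (inv h) = h
  wt : V → ℕ
  label : {h : H // inv h = h} ≃ S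

namespace WGraph

attribute [instance] fintypeV fintypeH

variable {S : Type u}

/-- The legs: trivial orbits of the involution. -/
abbrev Leg (Γ : WGraph S) : Type u := {h : Γ.H // Γ.inv h = h}

/-- The edges: free orbits `{h, inv h}` of the involution. -/
def Edge (Γ : WGraph S) : Type u := {e : Set Γ.H // ∃ h, Γ.inv h ≠ h ∧ e = {h, Γ.inv h}}

open Classical in
/-- The valence of a vertex: the number of half-edges attached to it. -/
noncomputable def val (Γ : WGraph S) (v : Γ.V) : ℕ :=
  (Finset.univ.filter fun h => Γ.bd h = v).card

/-- The number `2 w(v) + val(v) - 2`. -/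
noncomputable def chi (Γ : WGraph S) (v : Γ.V) : ℤ := 2 * (Γ.wt v : ℤ) + (Γ.val v : ℤ) - 2

/-- Every vertex satisfies `2 w(v) + val(v) ≥ 3`. -/
def Admissible (Γ : WGraph S) : Prop := ∀ v, 3 ≤ 2 * Γ.wt v + Γ.val v

/-- The graph is non-empty and connected. -/
def Connected (Γ : WGraph S) : Prop :=
  Nonempty Γ.V ∧ ∀ v v', Relation.ReflTransGen (fun a b => ∃ h, Γ.bd h = a ∧ Γ.bd (Γ.inv h) = b) v v'

/-- An isomorphism of weighted graphs which is compatible with the labellings of the legs. -/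
structure Iso (Γ Γ' : WGraph S) where
  toV : Γ.V ≃ Γ'.V
  toH : Γ.H ≃ Γ'.H
  bd_comm : ∀ h, toV (Γ.bd h) = Γ'.bd (toH h)
  inv_comm : ∀ h, toH (Γ.inv h) = Γ'.inv (toH h)
  wt_comm : ∀ v, Γ'.wt (toV v) = Γ.wt v
  label_comm : ∀ l : Γ.Leg, Γ'.label ⟨toH l.1, by rw [← inv_comm, l.2]⟩ = Γ.label l

/-- The bijection on legs induced by an isomorphism. -/
def Iso.legEquiv {Γ Γ' : WGraph S} (φ : Iso Γ Γ') : Γ.Leg ≃ Γ'.Leg :=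
  φ.toH.subtypeEquiv fun h => by rw [← φ.inv_comm, φ.toH.injective.eq_iff]

/-- The bijection on edges induced by an isomorphism. -/
def Iso.edgeEquiv {Γ Γ' : WGraph S} (φ : Iso Γ Γ') : Γ.Edge ≃ Γ'.Edge :=
  (Equiv.Set.congr φ.toH).subtypeEquiv fun e => by
    constructor
    · rintro ⟨h, hh, rfl⟩
      refine ⟨φ.toH h, ?_, ?_⟩
      · rw [← φ.inv_comm]; exact fun H => hh (φ.toH.injective H)
      · simp [Equiv.Set.congr, Set.image_pair, φ.inv_comm]
    · rintro ⟨h, hh, he⟩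
      obtain ⟨h, rfl⟩ := φ.toH.surjective h
      refine ⟨h, fun H => hh (by rw [← φ.inv_comm, H]), ?_⟩
      apply φ.toH.injective.image_injective
      simpa [Equiv.Set.congr, Set.image_pair, φ.inv_comm] using he

lemma Iso.mem_edgeEquiv {Γ Γ' : WGraph S} (φ : Iso Γ Γ') (e : Γ.Edge) (h : Γ.H) :
    φ.toH h ∈ (φ.edgeEquiv e).1 ↔ h ∈ e.1 := by
  change φ.toH h ∈ φ.toH '' e.1 ↔ _
  simp

/-! ### Contraction of an edge -/

section contract

variable (Γ : WGraph S) (e : Γ.Edge)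

lemma inv_mem_edge (h : Γ.H) : Γ.inv h ∈ e.1 ↔ h ∈ e.1 := by
  obtain ⟨e, k, hk, rfl⟩ := e
  simp only [Set.mem_insert_iff, Set.mem_singleton_iff]
  constructor
  · rintro (H | H)
    · right; rw [← H, Γ.inv_inv]
    · left; rw [← Γ.inv_inv h, H, Γ.inv_inv]
  · rintro (rfl | rfl)
    · exact Or.inr rfl
    · left; rw [Γ.inv_inv]

lemma ne_of_mem_edge {h : Γ.H} (hh : h ∈ e.1) : Γ.inv h ≠ h := by
  obtain ⟨e, k, hk, rfl⟩ := e
  rcases hh with rfl | rfl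
  · exact hk
  · rw [Γ.inv_inv]; exact hk.symm

lemma edge_eq_of_mem {h : Γ.H} (hh : h ∈ e.1) : e.1 = {h, Γ.inv h} := by
  obtain ⟨e, k, hk, rfl⟩ := e
  rcases hh with rfl | rfl
  · rfl
  · change ({k, Γ.inv k} : Set Γ.H) = _
    rw [Γ.inv_inv, Set.pair_comm]

variable {Γ} in
lemma edge_eq {e f : Γ.Edge} {h : Γ.H} (hh : h ∈ e.1) (hf : h ∈ f.1) : e = f :=
  Subtype.ext (by rw [edge_eq_of_mem Γ e hh, edge_eq_of_mem Γ f hf])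

/-- `∂ h₁ ∼ ∂ h₂`, where `e = {h₁, h₂}`. -/
def Glue (a b : Γ.V) : Prop := ∃ h ∈ e.1, Γ.bd h = a ∧ Γ.bd (Γ.inv h) = b

/-- The edge is a loop: both of its half-edges are attached to the same vertex. -/
def IsLoop : Prop := ∀ h ∈ e.1, Γ.bd h = Γ.bd (Γ.inv h)

open Classical in
/-- The graph `Γ/e` obtained by contracting the edge `e = {h₁, h₂}`: the vertices `∂ h₁` and
`∂ h₂` are identified and the half-edges `h₁, h₂` are removed. If `e` is not a loop, the new vertex
has weight `w(∂ h₁) + w(∂ h₂)`; if `e` is a loop, the weight of its vertex increases by `1`; the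
weights of the other vertices do not change. -/
noncomputable def contract : WGraph S where
  V := Quot (Γ.Glue e)
  H := {h : Γ.H // h ∉ e.1}
  fintypeV := Fintype.ofFinite _
  fintypeH := Fintype.ofFinite _
  bd h := Quot.mk _ (Γ.bd h.1)
  inv h := ⟨Γ.inv h.1, fun H => h.2 ((Γ.inv_mem_edge e h.1).1 H)⟩
  inv_inv h := Subtype.ext (Γ.inv_inv h.1)
  wt x := (∑ v with Quot.mk (Γ.Glue e) v = x, Γ.wt v) +
    if Γ.IsLoop e ∧ ∃ h ∈ e.1, Quot.mk (Γ.Glue e) (Γ.bd h) = x then 1 else 0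
  label :=
    { toFun := fun h => ⟨h.1.1, congrArg Subtype.val h.2⟩
      invFun := fun h => ⟨⟨h.1, fun H => Γ.ne_of_mem_edge e H h.2⟩, Subtype.ext h.2⟩
      left_inv := fun _ => rfl
      right_inv := fun _ => rfl : _ ≃ Γ.Leg }.trans Γ.label

/-- The quotient map on vertices. -/
def proj (v : Γ.V) : (Γ.contract e).V := Quot.mk (Γ.Glue e) v

lemma proj_surjective : Function.Surjective (Γ.proj e) := Quot.exists_rep

lemma proj_eq (h : Γ.H) (hh : h ∈ e.1) : Γ.proj e (Γ.bd h) = Γ.proj e (Γ.bd (Γ.inv h)) :=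
  Quot.sound ⟨h, hh, rfl, rfl⟩

lemma contract_bd (h : (Γ.contract e).H) : (Γ.contract e).bd h = Γ.proj e (Γ.bd h.1) := rfl

open Classical in
lemma contract_wt (x : (Γ.contract e).V) :
    (Γ.contract e).wt x = (∑ v with Γ.proj e v = x, Γ.wt v) +
      if Γ.IsLoop e ∧ ∃ h ∈ e.1, Γ.proj e (Γ.bd h) = x then 1 else 0 := rfl

/-- Contracting an edge does not change the set of legs. -/
def legContract : Γ.Leg ≃ (Γ.contract e).Leg where
  toFun h := ⟨⟨h.1, fun H => Γ.ne_of_mem_edge e H h.2⟩, Subtype.ext h.2⟩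
  invFun h := ⟨h.1.1, congrArg Subtype.val h.2⟩
  left_inv _ := rfl
  right_inv _ := rfl

/-- The edges of `Γ/e` are the edges of `Γ` other than `e`. -/
def edgeContract : {f : Γ.Edge // f ≠ e} ≃ (Γ.contract e).Edge where
  toFun f := ⟨Subtype.val ⁻¹' f.1.1, by
    obtain ⟨⟨_, h, hh, rfl⟩, hf⟩ := f
    refine ⟨⟨h, fun H => hf (edge_eq (h := h) (by simp) H)⟩,
      fun H => hh (congrArg Subtype.val H), ?_⟩
    ext x
    exact or_congr ⟨fun H => Subtype.ext H, fun H => congrArg Subtype.val H⟩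
      ⟨fun H => Subtype.ext H, fun H => congrArg Subtype.val H⟩⟩
  invFun f := ⟨⟨Subtype.val '' f.1, by
    obtain ⟨_, h, hh, rfl⟩ := f
    exact ⟨h.1, fun H => hh (Subtype.ext H), Set.image_pair _ _ _⟩⟩, by
    obtain ⟨_, h, hh, rfl⟩ := f
    intro H
    have H' : Subtype.val '' ({h, (Γ.contract e).inv h} : Set (Γ.contract e).H) = e.1 :=
      congrArg Subtype.val H
    exact h.2 (H'.subset ⟨h, Or.inl rfl, rfl⟩)⟩
  left_inv f := by
    apply Subtype.ext; apply Subtype.ext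
    ext x
    constructor
    · rintro ⟨y, hy, rfl⟩; exact hy
    · intro hx
      exact ⟨⟨x, fun H => f.2 (edge_eq hx H)⟩, hx, rfl⟩
  right_inv f := by
    apply Subtype.ext
    exact Set.preimage_image_eq _ Subtype.val_injective

lemma mem_edgeContract (f : {f : Γ.Edge // f ≠ e}) (h : (Γ.contract e).H) :
    h ∈ (Γ.edgeContract e f).1 ↔ h.1 ∈ f.1.1 := Iff.rfl

/-- If `ν = e₀ ∧ e₁ ∧ ⋯ ∧ e_k` is an ordering of the edges, this is the ordering
`e₀ ∧ ⋯ ∧ ê_i ∧ ⋯ ∧ e_k` of the edges of `Γ/e_i`. -/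
def contractOrder {k : ℕ} (ν : Fin (k + 1) ≃ Γ.Edge) (i : Fin (k + 1)) :
    Fin k ≃ (Γ.contract (ν i)).Edge :=
  ((finSuccAboveEquiv i).trans
    (ν.subtypeEquiv (p := fun j => j ≠ i) (q := fun f => f ≠ ν i)
      fun _ => by rw [ne_eq, ne_eq, ν.injective.eq_iff])).trans (Γ.edgeContract (ν i))

lemma mem_contractOrder {k : ℕ} (ν : Fin (k + 1) ≃ Γ.Edge) (i : Fin (k + 1)) (j : Fin k)
    (h : (Γ.contract (ν i)).H) :
    h ∈ (Γ.contractOrder ν i j).1 ↔ h.1 ∈ (ν (i.succAbove j)).1 := Iff.rfl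

lemma mk_eq_iff (a b : Γ.V) :
    Γ.proj e a = Γ.proj e b ↔ a = b ∨ Γ.Glue e a b := by
  constructor
  · intro H
    unfold proj at H
    have H' := Quot.eqvGen_exact H
    clear H
    induction H' with
    | rel x y h => exact Or.inr h
    | refl x => exact Or.inl rfl
    | symm x y _ ih =>
      rcases ih with rfl | ⟨h, hh, rfl, rfl⟩
      · exact Or.inl rfl
      · exact Or.inr ⟨Γ.inv h, (Γ.inv_mem_edge e h).2 hh, rfl, by rw [Γ.inv_inv]⟩
    | trans x y z _ _ ih1 ih2 =>
      rcases ih1 with rfl | ⟨h, hh, rfl, rfl⟩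
      · exact ih2
      · rcases ih2 with rfl | ⟨k, hk, h1, rfl⟩
        · exact Or.inr ⟨h, hh, rfl, rfl⟩
        · rw [Γ.edge_eq_of_mem e hh] at hk
          rcases hk with rfl | rfl
          · exact Or.inr ⟨k, hh, rfl, rfl⟩
          · left; rw [Γ.inv_inv]
  · rintro (rfl | h)
    · rfl
    · exact Quot.sound h

open Classical in
lemma card_halfEdges (e : Γ.Edge) (x : (Γ.contract e).V) :
    ∑ v with Γ.proj e v = x, Γ.val v =
      (Γ.contract e).val x +
        if ∃ h ∈ e.1, Γ.proj e (Γ.bd h) = x then 2 else 0 := by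
  have h1 : ∑ v with Γ.proj e v = x, Γ.val v =
      (Finset.univ.filter fun h : Γ.H => Γ.proj e (Γ.bd h) = x).card := by
    rw [Finset.card_eq_sum_card_fiberwise (f := Γ.bd)
      (t := Finset.univ.filter fun v => Γ.proj e v = x)]
    · refine Finset.sum_congr rfl fun v hv => ?_
      unfold val
      congr 1
      ext h
      simp only [Finset.mem_filter, Finset.mem_univ, true_and] at hv ⊢
      exact ⟨fun H => ⟨by rw [H, hv], H⟩, fun H => H.2⟩
    · intro h hh
      simpa using hh
  have h2 : (Γ.contract e).val x =
      (Finset.univ.filter fun h : Γ.H => Γ.proj e (Γ.bd h) = x ∧ h ∉ e.1).card := by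
    unfold val
    refine Finset.card_bij (fun h _ => h.1) ?_ ?_ ?_
    · intro h hh
      simp only [Finset.mem_filter, Finset.mem_univ, true_and] at hh ⊢
      exact ⟨hh, h.2⟩
    · intro h _ h' _ H
      exact Subtype.ext H
    · intro h hh
      simp only [Finset.mem_filter, Finset.mem_univ, true_and] at hh
      exact ⟨⟨h, hh.2⟩, Finset.mem_filter.2 ⟨Finset.mem_univ _, hh.1⟩, rfl⟩
  obtain ⟨h0, hh0⟩ : ∃ h, h ∈ e.1 := by
    obtain ⟨_, h, _, rfl⟩ := e
    exact ⟨h, by simp⟩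
  have hg : Γ.proj e (Γ.bd h0) = Γ.proj e (Γ.bd (Γ.inv h0)) :=
    Γ.proj_eq e h0 hh0
  have h3 : (Finset.univ.filter fun h : Γ.H => Γ.proj e (Γ.bd h) = x ∧ h ∈ e.1).card =
      if ∃ h ∈ e.1, Γ.proj e (Γ.bd h) = x then 2 else 0 := by
    have hex : (∃ h ∈ e.1, Γ.proj e (Γ.bd h) = x) ↔
        Γ.proj e (Γ.bd h0) = x := by
      rw [Γ.edge_eq_of_mem e hh0]
      simp [← hg]
    split_ifs with H
    · rw [hex] at H
      have : (Finset.univ.filter fun h : Γ.H => Γ.proj e (Γ.bd h) = x ∧ h ∈ e.1) =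
          {h0, Γ.inv h0} := by
        ext h
        rw [Γ.edge_eq_of_mem e hh0]
        simp only [Finset.mem_filter, Finset.mem_univ, true_and, Set.mem_insert_iff,
          Set.mem_singleton_iff, Finset.mem_insert, Finset.mem_singleton]
        constructor
        · exact fun h => h.2
        · rintro (rfl | rfl)
          · exact ⟨H, Or.inl rfl⟩
          · exact ⟨by rw [← hg, H], Or.inr rfl⟩
      rw [this, Finset.card_pair (Γ.ne_of_mem_edge e hh0).symm]
    · rw [Finset.card_eq_zero, Finset.filter_eq_empty_iff]
      rintro h - ⟨H1, H2⟩
      exact H ⟨h, H2, H1⟩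
  rw [h1, h2, ← h3, ← Finset.filter_filter, ← Finset.filter_filter, add_comm,
    Finset.card_filter_add_card_filter_not]

open Classical in
lemma card_fibre (e : Γ.Edge) (x : (Γ.contract e).V) :
    (Finset.univ.filter fun v => Γ.proj e v = x).card =
      1 + if ¬ Γ.IsLoop e ∧ ∃ h ∈ e.1, Γ.proj e (Γ.bd h) = x then 1 else 0 := by
  obtain ⟨v, rfl⟩ : ∃ v, Γ.proj e v = x := Γ.proj_surjective e x
  split_ifs with H
  · obtain ⟨H1, h, hh, H2⟩ := H
    have hne : Γ.bd h ≠ Γ.bd (Γ.inv h) := by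
      intro H
      refine H1 fun k hk => ?_
      rw [Γ.edge_eq_of_mem e hh] at hk
      rcases hk with rfl | rfl
      · exact H
      · rw [Γ.inv_inv, H]
    rw [← H2]
    have : (Finset.univ.filter fun v => Γ.proj e v = Γ.proj e (Γ.bd h)) =
        {Γ.bd h, Γ.bd (Γ.inv h)} := by
      ext u
      simp only [Finset.mem_filter, Finset.mem_univ, true_and, Finset.mem_insert,
        Finset.mem_singleton]
      rw [eq_comm, mk_eq_iff]
      constructor
      · rintro (H | ⟨k, hk, H3, rfl⟩)
        · exact Or.inl H.symm
        · rw [Γ.edge_eq_of_mem e hh] at hk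
          rcases hk with rfl | rfl
          · exact Or.inr rfl
          · left; rw [Γ.inv_inv]
      · rintro (rfl | rfl)
        · exact Or.inl rfl
        · exact Or.inr ⟨h, hh, rfl, rfl⟩
    rw [this, Finset.card_pair hne]
  · rw [add_zero, Finset.card_eq_one]
    refine ⟨v, ?_⟩
    ext u
    simp only [Finset.mem_filter, Finset.mem_univ, true_and, Finset.mem_singleton]
    rw [mk_eq_iff]
    constructor
    · rintro (rfl | ⟨h, hh, rfl, rfl⟩)
      · rfl
      · by_contra hne
        refine H ⟨fun hl => hne (hl h hh), Γ.inv h, (Γ.inv_mem_edge e h).2 hh, rfl⟩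
    · rintro rfl
      exact Or.inl rfl

open Classical in
/-- The number `2 w + val - 2` is additive under contraction of edges. -/
lemma chi_contract (e : Γ.Edge) (x : (Γ.contract e).V) :
    (Γ.contract e).chi x = ∑ v with Γ.proj e v = x, Γ.chi v := by
  have h1 := Γ.card_halfEdges e x
  have h2 := Γ.card_fibre e x
  have h3 := Γ.contract_wt e x
  unfold chi
  rw [Finset.sum_sub_distrib, Finset.sum_add_distrib, ← Finset.mul_sum, Finset.sum_const,
    ← Nat.cast_sum, ← Nat.cast_sum, h1, h2, h3]
  by_cases hl : Γ.IsLoop e <;>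
    by_cases hx : ∃ h ∈ e.1, Γ.proj e (Γ.bd h) = x <;>
    simp only [hl, hx, not_true_eq_false, not_false_eq_true, and_true, and_false, if_true,
      if_false, nsmul_eq_mul] <;> push_cast <;> ring

variable {Γ} in
lemma admissible_iff : Γ.Admissible ↔ ∀ v, 1 ≤ Γ.chi v := by
  unfold Admissible chi
  refine forall_congr' fun v => ?_
  omega

variable {Γ} in
lemma Admissible.contract (h : Γ.Admissible) : (Γ.contract e).Admissible := by
  classical
  rw [admissible_iff] at h ⊢
  intro x
  rw [chi_contract]
  obtain ⟨v, rfl⟩ : ∃ v, Γ.proj e v = x := Γ.proj_surjective e x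
  refine (h v).trans (Finset.single_le_sum (f := Γ.chi) (fun u _ => ?_) (by simp))
  exact zero_le_one.trans (h u)

variable {Γ} in
lemma Connected.contract (h : Γ.Connected) : (Γ.contract e).Connected := by
  obtain ⟨⟨v⟩, h⟩ := h
  refine ⟨⟨Quot.mk _ v⟩, fun x y => ?_⟩
  obtain ⟨a, rfl⟩ : ∃ v, Γ.proj e v = x := Γ.proj_surjective e x
  obtain ⟨b, rfl⟩ : ∃ v, Γ.proj e v = y := Γ.proj_surjective e y
  induction h a b with
  | refl => exact .refl
  | tail _ hbc ih =>
    obtain ⟨k, rfl, rfl⟩ := hbc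
    by_cases hk : k ∈ e.1
    · rwa [← Γ.proj_eq e k hk]
    · exact ih.tail ⟨⟨k, hk⟩, rfl, rfl⟩

lemma sum_chi_contract : ∑ x, (Γ.contract e).chi x = ∑ v, Γ.chi v := by
  classical
  simp_rw [chi_contract]
  exact Finset.sum_fiberwise _ _ _

end contract

/-! ### Isomorphisms between contractions -/

section isos

variable {Γ Γ' : WGraph S}

lemma val_comm (f : Γ.V ≃ Γ'.V) (g : Γ.H ≃ Γ'.H) (h : ∀ k, f (Γ.bd k) = Γ'.bd (g k)) (v : Γ.V) :
    Γ'.val (f v) = Γ.val v := by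
  classical
  symm
  refine Finset.card_bij (fun k _ => g k) ?_ (fun _ _ _ _ H => g.injective H) ?_
  · intro k hk
    simp only [Finset.mem_filter, Finset.mem_univ, true_and] at hk ⊢
    rw [← h, hk]
  · intro k hk
    obtain ⟨k, rfl⟩ := g.surjective k
    simp only [Finset.mem_filter, Finset.mem_univ, true_and] at hk ⊢
    rw [← h, f.injective.eq_iff] at hk
    exact ⟨k, hk, rfl⟩

lemma Iso.chi_comm (φ : Iso Γ Γ') (v : Γ.V) : Γ'.chi (φ.toV v) = Γ.chi v := by
  unfold chi
  rw [φ.wt_comm, val_comm φ.toV φ.toH φ.bd_comm]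

lemma wt_comm_of_chi (f : Γ.V ≃ Γ'.V) (g : Γ.H ≃ Γ'.H) (h : ∀ k, f (Γ.bd k) = Γ'.bd (g k))
    (hc : ∀ v, Γ'.chi (f v) = Γ.chi v) (v : Γ.V) : Γ'.wt (f v) = Γ.wt v := by
  have h1 := hc v
  have h2 := val_comm f g h v
  unfold chi at h1
  omega

lemma Iso.glue_iff (φ : Iso Γ Γ') (e : Γ.Edge) (e' : Γ'.Edge) (he : φ.edgeEquiv e = e')
    (a b : Γ.V) : Γ.Glue e a b ↔ Γ'.Glue e' (φ.toV a) (φ.toV b) := by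
  subst he
  constructor
  · rintro ⟨h, hh, rfl, rfl⟩
    exact ⟨φ.toH h, (φ.mem_edgeEquiv e h).2 hh, (φ.bd_comm h).symm,
      by rw [← φ.inv_comm, φ.bd_comm]⟩
  · rintro ⟨h, hh, h1, h2⟩
    obtain ⟨h, rfl⟩ := φ.toH.surjective h
    refine ⟨h, (φ.mem_edgeEquiv e h).1 hh, φ.toV.injective ?_, φ.toV.injective ?_⟩
    · rw [φ.bd_comm, h1]
    · rw [φ.bd_comm, φ.inv_comm, h2]

/-- An isomorphism sending `e` to `e'` induces an isomorphism of contractions. -/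
noncomputable def Iso.contract (φ : Iso Γ Γ') (e : Γ.Edge) (e' : Γ'.Edge)
    (he : φ.edgeEquiv e = e') : Iso (Γ.contract e) (Γ'.contract e') :=
  let f : (Γ.contract e).V ≃ (Γ'.contract e').V :=
    Quot.congr φ.toV fun a b => φ.glue_iff e e' he a b
  let g : (Γ.contract e).H ≃ (Γ'.contract e').H :=
    φ.toH.subtypeEquiv fun h => by subst he; rw [φ.mem_edgeEquiv]
  have hb : ∀ k, f ((Γ.contract e).bd k) = (Γ'.contract e').bd (g k) := fun k =>
    congrArg (Quot.mk (Γ'.Glue e')) (φ.bd_comm k.1)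
  { toV := f
    toH := g
    bd_comm := hb
    inv_comm := fun h => Subtype.ext (φ.inv_comm h.1)
    wt_comm := wt_comm_of_chi f g hb fun x => by
      classical
      rw [chi_contract, chi_contract]
      symm
      refine Finset.sum_equiv φ.toV (fun v => ?_) fun v _ => (φ.chi_comm v).symm
      simp only [Finset.mem_filter, Finset.mem_univ, true_and]
      rw [← f.injective.eq_iff]
      rfl
    label_comm := fun l => φ.label_comm ((Γ.legContract e).symm l) }

/-- Contracting `e` and then `f` is the same as contracting `f` and then `e`. -/
noncomputable def contractSwap (e f : Γ.Edge) (h : f ≠ e) (f' : (Γ.contract e).Edge)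
    (e' : (Γ.contract f).Edge) (hf : f' = Γ.edgeContract e ⟨f, h⟩)
    (he : e' = Γ.edgeContract f ⟨e, h.symm⟩) :
    Iso ((Γ.contract e).contract f') ((Γ.contract f).contract e') :=
  let F : ∀ (e f : Γ.Edge) (h : f ≠ e) (f' : (Γ.contract e).Edge)
    (e' : (Γ.contract f).Edge) (_ : f' = Γ.edgeContract e ⟨f, h⟩)
    (_ : e' = Γ.edgeContract f ⟨e, h.symm⟩),
    ((Γ.contract e).contract f').V → ((Γ.contract f).contract e').V :=
    fun e f h f' e' hf he => Quot.lift (Quot.lift (fun v => Quot.mk _ (Quot.mk _ v)) (by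
      rintro a b ⟨k, hk, rfl, rfl⟩
      have hk' : k ∉ f.1 := fun H => h (edge_eq H hk)
      exact Quot.sound ⟨⟨k, hk'⟩, by subst he; exact hk, rfl, rfl⟩)) (by
      rintro _ _ ⟨k, hk, rfl, rfl⟩
      subst hf
      exact congrArg (Quot.mk _) (Quot.sound ⟨k.1, hk, rfl, rfl⟩))
  let fV : ((Γ.contract e).contract f').V ≃ ((Γ.contract f).contract e').V :=
    { toFun := F e f h f' e' hf he
      invFun := F f e h.symm e' f' he hf
      left_inv := by rintro ⟨⟨v⟩⟩; rfl
      right_inv := by rintro ⟨⟨v⟩⟩; rfl }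
  let gH : ((Γ.contract e).contract f').H ≃ ((Γ.contract f).contract e').H :=
    { toFun := fun k => ⟨⟨k.1.1, fun H => k.2 (by subst hf; exact H)⟩,
        by subst he; exact k.1.2⟩
      invFun := fun k => ⟨⟨k.1.1, fun H => k.2 (by subst he; exact H)⟩,
        by subst hf; exact k.1.2⟩
      left_inv := fun _ => rfl
      right_inv := fun _ => rfl }
  have hb : ∀ k, fV (((Γ.contract e).contract f').bd k) =
    ((Γ.contract f).contract e').bd (gH k) := fun _ => rfl
  { toV := fV
    toH := gH
    bd_comm := hb
    inv_comm := fun _ => rfl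
    wt_comm := wt_comm_of_chi fV gH hb fun x => by
      classical
      have key : ∀ (e : Γ.Edge) (f' : (Γ.contract e).Edge) (x : ((Γ.contract e).contract f').V),
          ((Γ.contract e).contract f').chi x =
          ∑ v with (Γ.contract e).proj f' (Γ.proj e v) = x, Γ.chi v := by
        intro e f' x
        rw [chi_contract]
        simp_rw [chi_contract]
        rw [← Finset.sum_fiberwise_of_maps_to (g := Γ.proj e)
          (t := Finset.univ.filter fun y => (Γ.contract e).proj f' y = x)]
        · refine Finset.sum_congr rfl fun y hy => Finset.sum_congr ?_ fun _ _ => rfl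
          ext v
          simp only [Finset.mem_filter, Finset.mem_univ, true_and] at hy ⊢
          exact ⟨fun H => ⟨by rw [H, hy], H⟩, fun H => H.2⟩
        · intro v hv
          exact Finset.mem_filter.2 ⟨Finset.mem_univ _, (Finset.mem_filter.1 hv).2⟩
      rw [key, key]
      refine Finset.sum_congr ?_ fun _ _ => rfl
      ext v
      simp only [Finset.mem_filter, Finset.mem_univ, true_and]
      rw [← fV.injective.eq_iff]
      rfl
    label_comm := fun _ => rfl }

end isos

end WGraph

/-! ### The black graph complexes -/

/-- A connected admissible weighted graph with legs labelled by `S`, all of whose edges are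
black. -/
structure BlackGraph (S : Type u) extends WGraph S where
  admissible : toWGraph.Admissible
  connected : toWGraph.Connected

namespace BlackGraph

variable {S : Type u} (Γ : BlackGraph S)

/-- The black graph `Γ/e`. -/
noncomputable def contract (e : Γ.Edge) : BlackGraph S where
  toWGraph := Γ.toWGraph.contract e
  admissible := Γ.admissible.contract e
  connected := Γ.connected.contract e

/-- The internal degree `n ∑_v (2 w(v) + val(v) - 2)`. -/
noncomputable def degInt (n : ℕ) : ℤ := n * ∑ v, Γ.chi v

end BlackGraph

/-- A black graph `Γ` with an ordering `ν` of its edges and an ordering `ω` of its legs. It stands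
for the generator `(Γ, ν 0 ∧ ν 1 ∧ ⋯, (ω 0 ∧ ω 1 ∧ ⋯)^{⊗ n})` of
`det(ℚ^{E(Γ)}) ⊗ det(ℚ^{L(Γ)})^{⊗ n}`. -/
structure OrientedGraph (S : Type u) : Type (u + 1) where
  graph : BlackGraph S
  numEdges : ℕ
  ν : Fin numEdges ≃ graph.Edge
  ω : Fin (Nat.card S) ≃ graph.Leg

/-- The relations in the black graph complex: isomorphic graphs are identified, a permutation `σ`
of the order of the edges acts by `sign σ`, and a permutation `τ` of the order of the legs acts by
`(sign τ) ^ n`. -/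
inductive Relator {S : Type u} (n : ℕ) : (OrientedGraph S →₀ ℚ) → Prop
  | iso (Γ Γ' : BlackGraph S) (φ : WGraph.Iso Γ.toWGraph Γ'.toWGraph) (k : ℕ)
      (ν : Fin k ≃ Γ.Edge) (ω : Fin (Nat.card S) ≃ Γ.Leg) :
      Relator n (Finsupp.single ⟨Γ', k, ν.trans φ.edgeEquiv, ω.trans φ.legEquiv⟩ 1 -
        Finsupp.single ⟨Γ, k, ν, ω⟩ 1)
  | edges (Γ : BlackGraph S) (k : ℕ) (ν : Fin k ≃ Γ.Edge) (ω : Fin (Nat.card S) ≃ Γ.Leg)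
      (σ : Equiv.Perm (Fin k)) :
      Relator n (Finsupp.single ⟨Γ, k, σ.trans ν, ω⟩ 1 -
        Finsupp.single ⟨Γ, k, ν, ω⟩ ((Equiv.Perm.sign σ : ℤ) : ℚ))
  | legs (Γ : BlackGraph S) (k : ℕ) (ν : Fin k ≃ Γ.Edge) (ω : Fin (Nat.card S) ≃ Γ.Leg)
      (τ : Equiv.Perm (Fin (Nat.card S))) :
      Relator n (Finsupp.single ⟨Γ, k, ν, τ.trans ω⟩ 1 -
        Finsupp.single ⟨Γ, k, ν, ω⟩ (((Equiv.Perm.sign τ : ℤ) : ℚ) ^ n))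

/-- The vector space underlying the black graph complex `G^{E_n}(S)`. -/
abbrev GE (n : ℕ) (S : Type u) : Type (u + 1) :=
  (OrientedGraph S →₀ ℚ) ⧸ Submodule.span ℚ {x : OrientedGraph S →₀ ℚ | Relator n x}

namespace GE

variable {S : Type u} (n : ℕ)

/-- The class of an oriented graph in `G^{E_n}(S)`. -/
noncomputable def cls (A : OrientedGraph S) : GE n S := Submodule.Quotient.mk (Finsupp.single A 1)

lemma mk_single (A : OrientedGraph S) (c : ℚ) :
    (Submodule.Quotient.mk (Finsupp.single A c) : GE n S) = c • cls n A := by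
  rw [cls, ← Submodule.Quotient.mk_smul, Finsupp.smul_single, smul_eq_mul, mul_one]

lemma cls_edges (Γ : BlackGraph S) (k : ℕ) (ν : Fin k ≃ Γ.Edge) (ω : Fin (Nat.card S) ≃ Γ.Leg)
    (σ : Equiv.Perm (Fin k)) :
    cls n ⟨Γ, k, σ.trans ν, ω⟩ = ((Equiv.Perm.sign σ : ℤ) : ℚ) • cls n ⟨Γ, k, ν, ω⟩ := by
  rw [← mk_single]
  exact (Submodule.Quotient.eq _).2 (Submodule.subset_span (Relator.edges Γ k ν ω σ))

lemma cls_legs (Γ : BlackGraph S) (k : ℕ) (ν : Fin k ≃ Γ.Edge) (ω : Fin (Nat.card S) ≃ Γ.Leg)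
    (τ : Equiv.Perm (Fin (Nat.card S))) :
    cls n ⟨Γ, k, ν, τ.trans ω⟩ = ((Equiv.Perm.sign τ : ℤ) : ℚ) ^ n • cls n ⟨Γ, k, ν, ω⟩ := by
  rw [← mk_single]
  exact (Submodule.Quotient.eq _).2 (Submodule.subset_span (Relator.legs Γ k ν ω τ))

lemma cls_iso {Γ Γ' : BlackGraph S} (φ : WGraph.Iso Γ.toWGraph Γ'.toWGraph) {k : ℕ}
    {ν : Fin k ≃ Γ.Edge} {ω : Fin (Nat.card S) ≃ Γ.Leg}
    {ν' : Fin k ≃ Γ'.Edge} {ω' : Fin (Nat.card S) ≃ Γ'.Leg}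
    (hν : ∀ i h, h ∈ (ν i).1 ↔ φ.toH h ∈ (ν' i).1)
    (hω : ∀ i, φ.toH (ω i).1 = (ω' i).1) :
    cls n ⟨Γ', k, ν', ω'⟩ = cls n ⟨Γ, k, ν, ω⟩ := by
  obtain rfl : ν' = ν.trans φ.edgeEquiv := by
    ext i : 1
    apply Subtype.ext
    ext h
    obtain ⟨h, rfl⟩ := φ.toH.surjective h
    rw [← hν, Equiv.trans_apply, φ.mem_edgeEquiv]
  obtain rfl : ω' = ω.trans φ.legEquiv := by
    ext i : 1
    exact Subtype.ext (hω i).symm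
  exact (Submodule.Quotient.eq _).2 (Submodule.subset_span (Relator.iso Γ Γ' φ k ν ω))

/-- The term `(Γ/e, ν/e, ω^{⊗ n})` for `e = ν i`, without its sign. -/
noncomputable def contractTerm {k : ℕ} (Γ : BlackGraph S) (ν : Fin (k + 1) ≃ Γ.Edge)
    (ω : Fin (Nat.card S) ≃ Γ.Leg) (i : Fin (k + 1)) : OrientedGraph S :=
  ⟨Γ.contract (ν i), k, Γ.contractOrder ν i, ω.trans (Γ.legContract (ν i))⟩

/-- The differential on generators: the sum over all edges `e` of `(Γ/e, ν/e, ω^{⊗ n})`, where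
contracting `ν = e₀ ∧ e₁ ∧ ⋯` with `e = e_i` gives the sign `(-1)^i`. -/
noncomputable def dGen : OrientedGraph S → GE n S
  | ⟨_, 0, _, _⟩ => 0
  | ⟨Γ, _ + 1, ν, ω⟩ => ∑ i : Fin (_ + 1), (-1 : ℚ) ^ (i : ℕ) • cls n (contractTerm Γ ν ω i)

lemma exists_perm_succAbove {k : ℕ} (σ : Equiv.Perm (Fin (k + 1))) (i : Fin (k + 1)) :
    ∃ ρ : Equiv.Perm (Fin k), (∀ j, σ (i.succAbove j) = (σ i).succAbove (ρ j)) ∧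
      ((Equiv.Perm.sign ρ : ℤ) : ℚ) =
        (Equiv.Perm.sign σ : ℤ) * ((-1) ^ (i : ℕ) * (-1) ^ (σ i : ℕ)) := by
  obtain ⟨⟨p, ρ⟩, h⟩ := Equiv.Perm.decomposeFin.symm.surjective
    (i.cycleRange.symm.trans (σ.trans (σ i).cycleRange))
  have hp : p = 0 := by
    have := congrArg (fun f => f 0) h
    simpa using this
  subst hp
  refine ⟨ρ, fun j => ?_, ?_⟩
  · have := congrArg (fun f => f j.succ) h
    simp only [Equiv.Perm.decomposeFin_symm_apply_succ, Equiv.swap_self, Equiv.refl_apply,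
      Equiv.trans_apply, Fin.cycleRange_symm_succ] at this
    rw [← Fin.cycleRange_symm_succ (σ i), this, Equiv.symm_apply_apply]
  · have := congrArg Equiv.Perm.sign h
    simp only [Equiv.Perm.decomposeFin.symm_sign, if_true, one_mul, Equiv.Perm.sign_trans,
      Equiv.Perm.sign_symm, Fin.sign_cycleRange] at this
    rw [this]
    push_cast
    ring

lemma dGen_edges (Γ : BlackGraph S) (k : ℕ) (ν : Fin k ≃ Γ.Edge) (ω : Fin (Nat.card S) ≃ Γ.Leg)
    (σ : Equiv.Perm (Fin k)) :
    dGen n ⟨Γ, k, σ.trans ν, ω⟩ = ((Equiv.Perm.sign σ : ℤ) : ℚ) • dGen n ⟨Γ, k, ν, ω⟩ := by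
  cases k with
  | zero => simp [dGen]
  | succ k =>
    simp only [dGen]
    rw [← Equiv.sum_comp σ fun i : Fin (k + 1) =>
      (-1 : ℚ) ^ (i : ℕ) • cls n (contractTerm Γ ν ω i), Finset.smul_sum]
    refine Finset.sum_congr rfl fun i _ => ?_
    obtain ⟨ρ, h1, h2⟩ := exists_perm_succAbove σ i
    have h3 : Γ.contractOrder (σ.trans ν) i = ρ.trans (Γ.contractOrder ν (σ i)) := by
      ext j : 1
      apply Subtype.ext
      ext h
      change h.1 ∈ (ν (σ (i.succAbove j))).1 ↔ h.1 ∈ (ν ((σ i).succAbove (ρ j))).1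
      rw [h1]
    have h4 : cls n (contractTerm Γ (σ.trans ν) ω i) =
        ((Equiv.Perm.sign ρ : ℤ) : ℚ) • cls n (contractTerm Γ ν ω (σ i)) := by
      refine Eq.trans ?_ (cls_edges n (Γ.contract (ν (σ i))) k (Γ.contractOrder ν (σ i)) _ ρ)
      exact congrArg (fun x => cls n ⟨Γ.contract (ν (σ i)), k, x, _⟩) h3
    rw [h4, h2, smul_smul, smul_smul]
    congr 1
    have h5 : ((-1 : ℚ) ^ (i : ℕ)) * (-1) ^ (i : ℕ) = 1 := by
      rw [← mul_pow]; simp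
    linear_combination ((Equiv.Perm.sign σ : ℤ) : ℚ) * (-1) ^ (σ i : ℕ) * h5

lemma dGen_legs (Γ : BlackGraph S) (k : ℕ) (ν : Fin k ≃ Γ.Edge) (ω : Fin (Nat.card S) ≃ Γ.Leg)
    (τ : Equiv.Perm (Fin (Nat.card S))) :
    dGen n ⟨Γ, k, ν, τ.trans ω⟩ = ((Equiv.Perm.sign τ : ℤ) : ℚ) ^ n • dGen n ⟨Γ, k, ν, ω⟩ := by
  cases k with
  | zero => simp [dGen]
  | succ k =>
    simp only [dGen]
    rw [Finset.smul_sum]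
    refine Finset.sum_congr rfl fun i _ => ?_
    rw [smul_comm]
    congr 1
    exact cls_legs n (Γ.contract (ν i)) k (Γ.contractOrder ν i) (ω.trans (Γ.legContract (ν i))) τ

lemma dGen_iso (Γ Γ' : BlackGraph S) (φ : WGraph.Iso Γ.toWGraph Γ'.toWGraph) (k : ℕ)
    (ν : Fin k ≃ Γ.Edge) (ω : Fin (Nat.card S) ≃ Γ.Leg) :
    dGen n ⟨Γ', k, ν.trans φ.edgeEquiv, ω.trans φ.legEquiv⟩ = dGen n ⟨Γ, k, ν, ω⟩ := by
  cases k with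
  | zero => simp [dGen]
  | succ k =>
    simp only [dGen]
    refine Finset.sum_congr rfl fun i _ => ?_
    congr 1
    refine cls_iso n (Γ := Γ.contract (ν i)) (Γ' := Γ'.contract (φ.edgeEquiv (ν i)))
      (φ.contract (ν i) _ rfl) ?_ ?_
    · intro j h
      exact (φ.mem_edgeEquiv (ν (i.succAbove j)) h.1).symm
    · intro j
      rfl

lemma dGen_relator (x : OrientedGraph S →₀ ℚ) (hx : Relator n x) :
    Finsupp.linearCombination ℚ (dGen n) x = 0 := by
  cases hx with
  | iso Γ Γ' φ k ν ω => simp [dGen_iso]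
  | edges Γ k ν ω σ => simp [dGen_edges]
  | legs Γ k ν ω τ => simp [dGen_legs]

/-- The differential of `G^{E_n}(S)`. -/
noncomputable def d : GE n S →ₗ[ℚ] GE n S :=
  Submodule.liftQ _ (Finsupp.linearCombination ℚ (dGen n)) (by
    rw [Submodule.span_le]
    exact fun x hx => dGen_relator n x hx)

lemma d_cls (A : OrientedGraph S) : d n (cls n A) = dGen n A := by
  simp [d, cls, Submodule.liftQ_apply]

lemma cls_ext {x y : GE n S →ₗ[ℚ] GE n S} (h : ∀ A, x (cls n A) = y (cls n A)) : x = y := by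
  apply Submodule.linearMap_qext
  apply Finsupp.lhom_ext'
  intro A
  apply LinearMap.ext_ring
  exact h A

lemma d_contractTerm_swap {k : ℕ} (Γ : BlackGraph S) (ν : Fin (k + 2) ≃ Γ.Edge)
    (ω : Fin (Nat.card S) ≃ Γ.Leg) (i : Fin (k + 2)) (j : Fin (k + 1)) :
    cls n (contractTerm (Γ.contract (ν (i.succAbove j))) (Γ.contractOrder ν (i.succAbove j))
        (ω.trans (Γ.legContract _)) (j.predAbove i)) =
      cls n (contractTerm (Γ.contract (ν i)) (Γ.contractOrder ν i)
        (ω.trans (Γ.legContract _)) j) := by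
  have hne : ν (i.succAbove j) ≠ ν i := fun H => Fin.succAbove_ne i j (ν.injective H)
  refine cls_iso n (Γ := (Γ.contract (ν i)).contract (Γ.contractOrder ν i j))
    (Γ' := (Γ.contract (ν (i.succAbove j))).contract
      (Γ.contractOrder ν (i.succAbove j) (j.predAbove i)))
    (WGraph.contractSwap (ν i) (ν (i.succAbove j)) hne _ _ rfl ?_) ?_ ?_
  · apply Subtype.ext
    ext h
    change h.1 ∈ (ν ((i.succAbove j).succAbove (j.predAbove i))).1 ↔ h.1 ∈ (ν i).1
    rw [Fin.succAbove_succAbove_predAbove]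
  · intro l h
    change h.1.1 ∈ (ν (i.succAbove (j.succAbove l))).1 ↔
      h.1.1 ∈ (ν ((i.succAbove j).succAbove ((j.predAbove i).succAbove l))).1
    rw [Fin.succAbove_succAbove_succAbove_predAbove]
  · intro l
    rfl

lemma d_dGen (A : OrientedGraph S) : d n (dGen n A) = 0 := by
  obtain ⟨Γ, k, ν, ω⟩ := A
  rcases k with _ | _ | k
  · simp [dGen]
  · simp [dGen, d_cls, contractTerm]
  · simp only [dGen, map_sum, map_smul, d_cls]
    simp only [contractTerm, Finset.smul_sum, smul_smul, ← pow_add]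
    rw [← Finset.sum_product']
    refine Finset.sum_involution (fun x _ => (x.1.succAbove x.2, x.2.predAbove x.1)) ?_ ?_ ?_ ?_
    · rintro ⟨i, j⟩ -
      have := d_contractTerm_swap n Γ ν ω i j
      simp only [contractTerm] at this
      rw [this, Fin.neg_one_pow_succAbove_add_predAbove, neg_smul, add_neg_cancel]
    · rintro ⟨i, j⟩ - - H
      exact Fin.succAbove_ne i j (congrArg Prod.fst H)
    · simp
    · rintro ⟨i, j⟩ -
      exact Prod.ext (Fin.succAbove_succAbove_predAbove i j) (Fin.predAbove_predAbove_succAbove i j)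

lemma d_d (x : GE n S) : d n (d n x) = 0 := by
  have : d n ∘ₗ d n = (0 : GE n S →ₗ[ℚ] GE n S) :=
    cls_ext n fun A => by simp [d_cls, d_dGen]
  exact congrArg (fun f => f x) this

/-- The part of `G^{E_n}(S)` of internal degree `q` and total degree `m`: the total degree of a
graph is the sum of its internal degree and its number of edges. -/
noncomputable def piece (n : ℕ) (S : Type u) (q m : ℤ) : Submodule ℚ (GE n S) :=
  Submodule.span ℚ {x | ∃ A : OrientedGraph S,
    A.graph.degInt n = q ∧ A.graph.degInt n + A.numEdges = m ∧ cls n A = x}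

lemma d_piece (q : ℤ) {m m' : ℤ} (h : m' + 1 = m) : piece n S q m ≤ (piece n S q m').comap (d n) := by
  refine Submodule.span_le.2 ?_
  rintro _ ⟨⟨Γ, k, ν, ω⟩, h1, h2, rfl⟩
  rw [SetLike.mem_coe, Submodule.mem_comap, d_cls]
  cases k with
  | zero => exact Submodule.zero_mem _
  | succ k =>
    refine Submodule.sum_mem _ fun i _ => Submodule.smul_mem _ _ (Submodule.subset_span
      ⟨contractTerm Γ ν ω i, ?_, ?_, rfl⟩)
    · rw [← h1]
      exact congrArg (fun x => (n : ℤ) * x) (Γ.sum_chi_contract (ν i))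
    · have h3 : (contractTerm Γ ν ω i).graph.degInt n = Γ.degInt n :=
        congrArg (fun x => (n : ℤ) * x) (Γ.sum_chi_contract (ν i))
      have h4 : (contractTerm Γ ν ω i).numEdges = k := rfl
      rw [h3, h4]
      simp only at h2
      push_cast at h2
      omega

/-- The span of the graphs which have some vertex of positive weight. -/
noncomputable def positive (n : ℕ) (S : Type u) : Submodule ℚ (GE n S) :=
  Submodule.span ℚ {x | ∃ A : OrientedGraph S, (∃ v, 0 < A.graph.wt v) ∧ cls n A = x}

lemma d_positive : positive n S ≤ (positive n S).comap (d n) := by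
  classical
  refine Submodule.span_le.2 ?_
  rintro _ ⟨⟨Γ, k, ν, ω⟩, ⟨v, hv⟩, rfl⟩
  rw [SetLike.mem_coe, Submodule.mem_comap, d_cls]
  cases k with
  | zero => exact Submodule.zero_mem _
  | succ k =>
    refine Submodule.sum_mem _ fun i _ => Submodule.smul_mem _ _ (Submodule.subset_span
      ⟨contractTerm Γ ν ω i, ⟨Γ.proj (ν i) v, ?_⟩, rfl⟩)
    change 0 < (Γ.toWGraph.contract (ν i)).wt (Γ.proj (ν i) v)
    rw [WGraph.contract_wt]
    refine Nat.add_pos_left (hv.trans_le ?_) _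
    exact Finset.single_le_sum (f := Γ.wt) (fun _ _ => Nat.zero_le _) (by simp)

end GE

/-- The vector space underlying the black graph complex `G^{Z_n}(S)`: the quotient of `G^{E_n}(S)`
by the graphs which have some vertex of positive weight. -/
abbrev GZ (n : ℕ) (S : Type u) : Type (u + 1) := GE n S ⧸ GE.positive n S

namespace GZ

variable {S : Type u} (n : ℕ)

/-- The differential of `G^{Z_n}(S)`. -/
noncomputable def d : GZ n S →ₗ[ℚ] GZ n S :=
  (GE.positive n S).mapQ (GE.positive n S) (GE.d n) (GE.d_positive n)

lemma d_mk (x : GE n S) :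
    d n ((GE.positive n S).mkQ x) = (GE.positive n S).mkQ (GE.d n x) := rfl

lemma d_d (x : GZ n S) : d n (d n x) = 0 := by
  obtain ⟨x, rfl⟩ := (GE.positive n S).mkQ_surjective x
  rw [d_mk, d_mk, GE.d_d, map_zero]

/-- The part of `G^{Z_n}(S)` of internal degree `q` and total degree `m`. -/
noncomputable def piece (n : ℕ) (S : Type u) (q m : ℤ) : Submodule ℚ (GZ n S) :=
  (GE.piece n S q m).map (GE.positive n S).mkQ

lemma d_piece (q : ℤ) {m m' : ℤ} (h : m' + 1 = m) :
    piece n S q m ≤ (piece n S q m').comap (d n) := by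
  rintro _ ⟨x, hx, rfl⟩
  exact ⟨GE.d n x, GE.d_piece n q h hx, (d_mk n x).symm⟩

end GZ

open CategoryTheory in
/-- The chain complex `G^{E_n}(S)_q`, the part of `G^{E_n}(S)` of internal degree `q`, with its
total grading. -/
noncomputable def complexGE (n : ℕ) (S : Type u) (q : ℤ) :
    ChainComplex (ModuleCat.{u + 1} ℚ) ℤ where
  X m := ModuleCat.of ℚ (GE.piece n S q m)
  d m m' := if h : m' + 1 = m then ModuleCat.ofHom ((GE.d n).restrict (GE.d_piece n q h)) else 0
  shape m m' h := dif_neg h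
  d_comp_d' m m' m'' h h' := by
    have e : m' + 1 = m := h
    have e' : m'' + 1 = m' := h'
    rw [dif_pos e, dif_pos e']
    ext x
    exact GE.d_d n x.1

open CategoryTheory in
/-- The chain complex `G^{Z_n}(S)_q`, the part of `G^{Z_n}(S)` of internal degree `q`, with its
total grading. -/
noncomputable def complexGZ (n : ℕ) (S : Type u) (q : ℤ) :
    ChainComplex (ModuleCat.{u + 1} ℚ) ℤ where
  X m := ModuleCat.of ℚ (GZ.piece n S q m)
  d m m' := if h : m' + 1 = m then ModuleCat.ofHom ((GZ.d n).restrict (GZ.d_piece n q h)) else 0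
  shape m m' h := dif_neg h
  d_comp_d' m m' m'' h h' := by
    have e : m' + 1 = m := h
    have e' : m'' + 1 = m' := h'
    rw [dif_pos e, dif_pos e']
    ext x
    exact GZ.d_d n x.1

open CategoryTheory in
/-- The quotient map `G^{E_n}(S)_q → G^{Z_n}(S)_q`. -/
noncomputable def quotientMap (n : ℕ) (S : Type u) (q : ℤ) :
    complexGE n S q ⟶ complexGZ n S q where
  f m := ModuleCat.ofHom ((GE.positive n S).mkQ.restrict
    fun _ hx => Submodule.mem_map_of_mem hx)
  comm' m m' h := by
    have h' : m' + 1 = m := h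
    simp only [complexGE, complexGZ, dif_pos h']
    rfl

/-- The relative homology `H_{p+q}(G^{Z_n}(S), G^{E_n}(S))_q`: the homology in total degree `p + q`
of the mapping cone of `G^{E_n}(S)_q → G^{Z_n}(S)_q`. -/
noncomputable def relativeHomology (n : ℕ) (S : Type u) (p q : ℤ) : ModuleCat.{u + 1} ℚ :=
  (HomologicalComplex.homotopyCofiber (quotientMap n S q)).homology (p + q)

/-!
The map `G^{E_n}(S)_q → G^{Z_n}(S)_q` is surjective, and its kernel is the complex spanned by the
graphs with a vertex of positive weight, so the relative homology in degree `m` is the homology of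
this kernel in degree `m - 1`. The kernel has a contracting homotopy up to a filtration.

For a vertex `v` of positive weight let `Γ_v` (`WGraph.expand`) be the graph in which one unit of
the weight of `v` is moved to a new univalent vertex, joined to `v` by a new edge, and let `h`
(`GE.split`) send `Γ` to `∑_v w(v) Γ_v`, the new edge coming first in the ordering. The terms of `h`
for which `Γ_v` is not admissible, those where `v` is univalent of weight `1`, are `0`. Contracting
the new edge of `Γ_v` gives back `Γ`, and contracting an old edge `e` gives `(Γ/e)_{v'}`, where `v'`
is the image of `v`. The weight of a vertex of `Γ/e` is the sum of the weights of its preimages when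
`e` is not a loop, so these last terms cancel in `d h + h d`. If `v` is univalent of weight `1`, the
edge `e` at `v` contributes instead, since `(Γ/e)_{v'}` is isomorphic to `Γ`. Altogether `d h + h d`
is multiplication by the total weight `W`, up to terms in which a loop is contracted, and those
have total weight `W + 1` (`GE.homotopy_cls`).

The argument for univalent vertices of weight `1` needs the half-edge at `v` not to be a leg. By
connectedness this holds unless `Γ` consists of the single vertex `v` of weight `1` with one leg,
and then the internal degree is `n`. As the total weight is bounded in terms of `q`, descending
induction over the filtration by total weight shows that the kernel is acyclic for `q ≠ n`
(`GE.exists_d_eq`). For `q = n` the only graph in the kernel is that exceptional one. It has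
`|S| = 1` and total degree `n`, and its class is detected by `coneFunctional`.
-/

namespace WGraph

variable {S : Type u} (Γ : WGraph S)

/-! ### Splitting off a vertex of weight one -/

/-- The involution on the half-edges of `Γ` together with two new ones, which it exchanges. -/
def expandInv (h : Option (Option Γ.H)) : Option (Option Γ.H) :=
  h.elim (some none) fun k => k.elim none fun l => some (some (Γ.inv l))

open Classical in
/-- The graph obtained from `Γ` by moving one unit of the weight of `v` to a new univalent vertex
of weight `1`, joined to `v` by a new edge. The new vertex is `none`; the new half-edges are
`some none`, attached to `v`, and `none`, attached to the new vertex. If `v` has weight `0`, then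
its weight stays `0`. -/
noncomputable def expand (v : Γ.V) : WGraph S where
  V := Option Γ.V
  H := Option (Option Γ.H)
  bd h := h.elim none fun k => some (k.elim v Γ.bd)
  inv := Γ.expandInv
  inv_inv := by rintro (_ | _ | h) <;> simp [expandInv, Γ.inv_inv]
  wt x := x.elim 1 fun u => if u = v then Γ.wt u - 1 else Γ.wt u
  label :=
    (Equiv.ofBijective (β := {h // Γ.expandInv h = h})
      (fun l : Γ.Leg => ⟨some (some l.1), by simp [expandInv, l.2]⟩) (by
        constructor
        · intro a b h
          simpa [Subtype.ext_iff] using h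
        · rintro ⟨_ | _ | h, hh⟩
          · simp [expandInv] at hh
          · simp [expandInv] at hh
          · exact ⟨⟨h, by simpa [expandInv] using hh⟩, rfl⟩)).symm.trans Γ.label

variable (v : Γ.V)

/-- A vertex of `Γ`, as a vertex of `Γ.expand v`. -/
def oldV (u : Γ.V) : (Γ.expand v).V := some u

/-- The new vertex of `Γ.expand v`. -/
def newV : (Γ.expand v).V := none

/-- A half-edge of `Γ`, as a half-edge of `Γ.expand v`. -/
def oldH (h : Γ.H) : (Γ.expand v).H := some (some h)

/-- The new half-edge of `Γ.expand v` attached to `v`. -/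
def nearH : (Γ.expand v).H := some none

/-- The new half-edge of `Γ.expand v` attached to the new vertex. -/
def farH : (Γ.expand v).H := none

variable {Γ v} in
@[elab_as_elim]
lemma expandV_cases {p : (Γ.expand v).V → Prop} (new : p (Γ.newV v)) (old : ∀ u, p (Γ.oldV v u))
    (x : (Γ.expand v).V) : p x :=
  match x with
  | none => new
  | some u => old u

variable {Γ v} in
@[elab_as_elim]
lemma expandH_cases {p : (Γ.expand v).H → Prop} (far : p (Γ.farH v)) (near : p (Γ.nearH v))
    (old : ∀ h, p (Γ.oldH v h)) (x : (Γ.expand v).H) : p x :=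
  match x with
  | none => far
  | some none => near
  | some (some h) => old h

variable {Γ v} in
@[simp] lemma oldV_inj {a b : Γ.V} : Γ.oldV v a = Γ.oldV v b ↔ a = b :=
  (Option.some_injective _).eq_iff

variable {Γ v} in
@[simp] lemma oldH_inj {a b : Γ.H} : Γ.oldH v a = Γ.oldH v b ↔ a = b :=
  ((Option.some_injective _).comp (Option.some_injective _)).eq_iff

variable {Γ v} in
@[simp] lemma oldV_ne_newV (u : Γ.V) : Γ.oldV v u ≠ Γ.newV v := Option.some_ne_none u

variable {Γ v} in
@[simp] lemma newV_ne_oldV (u : Γ.V) : Γ.newV v ≠ Γ.oldV v u := (Option.some_ne_none u).symm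

variable {Γ v} in
@[simp] lemma oldH_ne_farH (h : Γ.H) : Γ.oldH v h ≠ Γ.farH v := Option.some_ne_none _

variable {Γ v} in
@[simp] lemma farH_ne_oldH (h : Γ.H) : Γ.farH v ≠ Γ.oldH v h := (Option.some_ne_none _).symm

variable {Γ v} in
@[simp] lemma oldH_ne_nearH (h : Γ.H) : Γ.oldH v h ≠ Γ.nearH v := fun H =>
  Option.some_ne_none h (Option.some_injective _ H)

variable {Γ v} in
@[simp] lemma nearH_ne_oldH (h : Γ.H) : Γ.nearH v ≠ Γ.oldH v h := (oldH_ne_nearH h).symm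

@[simp] lemma nearH_ne_farH : Γ.nearH v ≠ Γ.farH v := Option.some_ne_none _

@[simp] lemma farH_ne_nearH : Γ.farH v ≠ Γ.nearH v := (Option.some_ne_none _).symm

lemma sum_expandV {M : Type*} [AddCommMonoid M] (f : (Γ.expand v).V → M) :
    ∑ x, f x = f (Γ.newV v) + ∑ u, f (Γ.oldV v u) :=
  Fintype.sum_option f

lemma sum_expandH {M : Type*} [AddCommMonoid M] (f : (Γ.expand v).H → M) :
    ∑ x, f x = f (Γ.farH v) + (f (Γ.nearH v) + ∑ h, f (Γ.oldH v h)) :=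
  (Fintype.sum_option f).trans (congrArg _ (Fintype.sum_option fun h => f (some h)))

@[simp] lemma expand_inv_old (h : Γ.H) : (Γ.expand v).inv (Γ.oldH v h) = Γ.oldH v (Γ.inv h) := rfl

@[simp] lemma expand_inv_near : (Γ.expand v).inv (Γ.nearH v) = Γ.farH v := rfl

@[simp] lemma expand_inv_far : (Γ.expand v).inv (Γ.farH v) = Γ.nearH v := rfl

@[simp] lemma expand_bd_old (h : Γ.H) : (Γ.expand v).bd (Γ.oldH v h) = Γ.oldV v (Γ.bd h) := rfl

@[simp] lemma expand_bd_near : (Γ.expand v).bd (Γ.nearH v) = Γ.oldV v v := rfl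

@[simp] lemma expand_bd_far : (Γ.expand v).bd (Γ.farH v) = Γ.newV v := rfl

lemma expand_wt_new : (Γ.expand v).wt (Γ.newV v) = 1 := rfl

open Classical in
lemma expand_wt_old (u : Γ.V) :
    (Γ.expand v).wt (Γ.oldV v u) = if u = v then Γ.wt u - 1 else Γ.wt u := rfl

/-- Splitting off a vertex does not change the set of legs. -/
noncomputable def legExpand : Γ.Leg ≃ (Γ.expand v).Leg :=
  Equiv.ofBijective (fun l : Γ.Leg => ⟨Γ.oldH v l.1, by rw [expand_inv_old, l.2]⟩) (by
    constructor
    · intro a b h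
      exact Subtype.ext (oldH_inj.1 (congrArg Subtype.val h))
    · rintro ⟨h, hh⟩
      induction h using expandH_cases with
      | far => exact absurd hh (Γ.nearH_ne_farH v)
      | near => exact absurd hh (Γ.farH_ne_nearH v)
      | old h => exact ⟨⟨h, oldH_inj.1 hh⟩, rfl⟩)

lemma legExpand_coe (l : Γ.Leg) : (Γ.legExpand v l).1 = Γ.oldH v l.1 := rfl

lemma expand_label (l : Γ.Leg) : (Γ.expand v).label (Γ.legExpand v l) = Γ.label l :=
  congrArg Γ.label (Equiv.ofBijective_symm_apply_apply _ _ l)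

/-- The edge joining `v` to the new vertex. -/
def newEdge : (Γ.expand v).Edge :=
  ⟨{Γ.farH v, Γ.nearH v}, Γ.farH v, by rw [expand_inv_far]; exact Γ.nearH_ne_farH v, rfl⟩

/-- The edge of `Γ.expand v` given by an edge of `Γ`. -/
def oldEdge (e : Γ.Edge) : (Γ.expand v).Edge :=
  ⟨Γ.oldH v '' e.1, by
    obtain ⟨_, h, hh, rfl⟩ := e
    exact ⟨Γ.oldH v h, fun H => hh (oldH_inj.1 H), Set.image_pair _ _ _⟩⟩

/-- The edges of `Γ.expand v` are the new edge and the edges of `Γ`. -/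
noncomputable def edgeExpand : Option Γ.Edge ≃ (Γ.expand v).Edge :=
  Equiv.ofBijective (fun e => e.elim (Γ.newEdge v) (Γ.oldEdge v)) (by
    have hne : ∀ e, Γ.newEdge v ≠ Γ.oldEdge v e := by
      intro e H
      have : Γ.farH v ∈ (Γ.oldEdge v e).1 := by
        rw [← H]; exact Or.inl rfl
      obtain ⟨_, _, h⟩ := this
      exact oldH_ne_farH _ h
    constructor
    · rintro (_ | e) (_ | f) H
      · rfl
      · exact absurd H (hne f)
      · exact absurd H.symm (hne e)
      · have hinj : Function.Injective (Γ.oldH v) := fun a b h => oldH_inj.1 h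
        exact congrArg some (Subtype.ext (hinj.image_injective (congrArg Subtype.val H)))
    · rintro ⟨_, h, hh, rfl⟩
      induction h using expandH_cases with
      | far => exact ⟨none, rfl⟩
      | near => exact ⟨none, Subtype.ext (Set.pair_comm _ _)⟩
      | old h =>
        have h0 : Γ.inv h ≠ h := fun H => hh (by rw [expand_inv_old, H])
        exact ⟨some ⟨{h, Γ.inv h}, h, h0, rfl⟩, Subtype.ext (Set.image_pair _ _ _)⟩)

/-- If `ν = e₀ ∧ ⋯ ∧ e_k` is an ordering of the edges of `Γ` and `e` is the new edge, this is the
ordering `e ∧ e₀ ∧ ⋯ ∧ e_k` of the edges of `Γ.expand v`. -/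
noncomputable def expandOrder {k : ℕ} (ν : Fin k ≃ Γ.Edge) : Fin (k + 1) ≃ (Γ.expand v).Edge :=
  ((finSuccEquiv k).trans ν.optionCongr).trans (Γ.edgeExpand v)

lemma expandOrder_zero {k : ℕ} (ν : Fin k ≃ Γ.Edge) : Γ.expandOrder v ν 0 = Γ.newEdge v := by
  rw [expandOrder, Equiv.trans_apply, Equiv.trans_apply, finSuccEquiv_zero]
  rfl

lemma expandOrder_succ {k : ℕ} (ν : Fin k ≃ Γ.Edge) (i : Fin k) :
    Γ.expandOrder v ν i.succ = Γ.oldEdge v (ν i) := by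
  rw [expandOrder, Equiv.trans_apply, Equiv.trans_apply, finSuccEquiv_succ]
  rfl

variable {Γ v} in
@[simp] lemma old_mem_newEdge (h : Γ.H) : Γ.oldH v h ∉ (Γ.newEdge v).1 := by
  rintro (H | H)
  · exact oldH_ne_farH _ H
  · exact oldH_ne_nearH _ H

@[simp] lemma near_mem_newEdge : Γ.nearH v ∈ (Γ.newEdge v).1 := Or.inr rfl

@[simp] lemma far_mem_newEdge : Γ.farH v ∈ (Γ.newEdge v).1 := Or.inl rfl

variable {Γ v} in
@[simp] lemma old_mem_oldEdge (e : Γ.Edge) (h : Γ.H) :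
    Γ.oldH v h ∈ (Γ.oldEdge v e).1 ↔ h ∈ e.1 := by
  constructor
  · rintro ⟨k, hk, H⟩
    obtain rfl : k = h := oldH_inj.1 H
    exact hk
  · exact fun H => ⟨h, H, rfl⟩

variable {Γ v} in
@[simp] lemma near_mem_oldEdge (e : Γ.Edge) : Γ.nearH v ∉ (Γ.oldEdge v e).1 := by
  rintro ⟨_, _, H⟩
  exact oldH_ne_nearH _ H

variable {Γ v} in
@[simp] lemma far_mem_oldEdge (e : Γ.Edge) : Γ.farH v ∉ (Γ.oldEdge v e).1 := by
  rintro ⟨_, _, H⟩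
  exact oldH_ne_farH _ H

open Classical in
lemma val_eq_sum (Γ : WGraph S) (u : Γ.V) : Γ.val u = ∑ h, if Γ.bd h = u then 1 else 0 := by
  unfold val
  rw [Finset.card_filter]

lemma expand_val_new : (Γ.expand v).val (Γ.newV v) = 1 := by
  classical
  rw [val_eq_sum, sum_expandH]
  simp

open Classical in
lemma expand_val_old (u : Γ.V) :
    (Γ.expand v).val (Γ.oldV v u) = Γ.val u + if u = v then 1 else 0 := by
  rw [val_eq_sum, val_eq_sum, sum_expandH]
  simp [add_comm, eq_comm]

lemma expand_chi_new : (Γ.expand v).chi (Γ.newV v) = 1 := by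
  unfold chi
  rw [expand_val_new, expand_wt_new]
  norm_num

variable {v}

open Classical in
lemma expand_chi_old (hv : 0 < Γ.wt v) (u : Γ.V) :
    (Γ.expand v).chi (Γ.oldV v u) = Γ.chi u - if u = v then 1 else 0 := by
  unfold chi
  rw [expand_val_old, expand_wt_old]
  split_ifs with h
  · subst h
    omega
  · simp

/-- The total weight of a graph. -/
def totalWt (Γ : WGraph S) : ℕ := ∑ v, Γ.wt v

lemma sum_chi_expand (hv : 0 < Γ.wt v) : ∑ x, (Γ.expand v).chi x = ∑ u, Γ.chi u := by
  classical
  rw [sum_expandV, expand_chi_new]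
  simp [Γ.expand_chi_old hv]

lemma totalWt_expand (hv : 0 < Γ.wt v) : (Γ.expand v).totalWt = Γ.totalWt := by
  classical
  unfold totalWt
  rw [sum_expandV, expand_wt_new]
  simp_rw [expand_wt_old]
  have h : ∀ f : Γ.V → ℕ, ∑ u, f u = f v + ∑ u ∈ Finset.univ.erase v, f u := fun f =>
    (Finset.add_sum_erase _ f (Finset.mem_univ v)).symm
  rw [h, h Γ.wt, Finset.sum_congr rfl fun u hu => if_neg (Finset.ne_of_mem_erase hu), if_pos rfl,
    ← add_assoc, Nat.add_sub_cancel' hv]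

lemma Admissible.expand {Γ : WGraph S} {v : Γ.V} (h : Γ.Admissible) (hv : 0 < Γ.wt v)
    (hc : 2 ≤ Γ.chi v) : (Γ.expand v).Admissible := by
  classical
  rw [admissible_iff] at h ⊢
  intro x
  induction x using expandV_cases with
  | new => rw [expand_chi_new]
  | old u =>
    rw [Γ.expand_chi_old hv]
    split_ifs with hu
    · subst hu; omega
    · have := h u; omega

lemma two_le_chi_of_admissible_expand (hv : 0 < Γ.wt v) (h : (Γ.expand v).Admissible) :
    2 ≤ Γ.chi v := by
  classical
  rw [admissible_iff] at h
  have := h (Γ.oldV v v)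
  rw [Γ.expand_chi_old hv, if_pos rfl] at this
  omega

lemma Connected.expand {Γ : WGraph S} (h : Γ.Connected) (v : Γ.V) : (Γ.expand v).Connected := by
  refine ⟨⟨Γ.newV v⟩, ?_⟩
  have key : ∀ a b : Γ.V, Relation.ReflTransGen
      (fun a b => ∃ h, (Γ.expand v).bd h = a ∧ (Γ.expand v).bd ((Γ.expand v).inv h) = b)
      (Γ.oldV v a) (Γ.oldV v b) := by
    intro a b
    have := h.2 a b
    induction this with
    | refl => exact .refl
    | tail _ hbc ih =>
      obtain ⟨k, rfl, rfl⟩ := hbc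
      exact ih.tail ⟨Γ.oldH v k, rfl, rfl⟩
  intro a b
  induction a using expandV_cases with
  | new =>
    induction b using expandV_cases with
    | new => exact .refl
    | old b => exact (Relation.ReflTransGen.single ⟨Γ.farH v, rfl, rfl⟩).trans (key v b)
  | old a =>
    induction b using expandV_cases with
    | new => exact (key a v).tail ⟨Γ.nearH v, rfl, rfl⟩
    | old b => exact key a b

end WGraph

namespace WGraph

variable {S : Type u}

/-! ### Isomorphisms involving contractions and expansions -/

lemma wt_le_wt_proj {Γ : WGraph S} (e : Γ.Edge) (v : Γ.V) :
    Γ.wt v ≤ (Γ.contract e).wt (Γ.proj e v) := by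
  classical
  rw [contract_wt]
  exact (Finset.single_le_sum (f := Γ.wt) (fun _ _ => Nat.zero_le _) (by simp)).trans
    (Nat.le_add_right _ _)

/-- A criterion for `Γ'` to be isomorphic to `Γ/e`: there are a surjection `f` on vertices, whose
fibres are those of the projection to `Γ/e` and along which `2 w + val - 2` is additive, and a
compatible injection `g` of the half-edges of `Γ'` onto the half-edges of `Γ` outside `e`. -/
noncomputable def isoContract {Γ Γ' : WGraph S} (e : Γ.Edge) (f : Γ.V → Γ'.V) (g : Γ'.H → Γ.H)
    (hf : Function.Surjective f) (hfe : ∀ a b, f a = f b ↔ Γ.proj e a = Γ.proj e b)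
    (hg : Function.Injective g) (hge : ∀ h, h ∉ e.1 ↔ ∃ k, g k = h)
    (hbd : ∀ k, f (Γ.bd (g k)) = Γ'.bd k) (hinv : ∀ k, g (Γ'.inv k) = Γ.inv (g k))
    (hlabel : ∀ (l : Γ'.Leg) (l' : Γ.Leg), l'.1 = g l.1 → Γ.label l' = Γ'.label l)
    (hchi : ∀ x y, (∀ a, Γ.proj e a = x ↔ f a = y) →
      (Γ.contract e).chi x = Γ'.chi y) : Iso Γ' (Γ.contract e) :=
  let F : (Γ.contract e).V → Γ'.V :=
    Quot.lift f fun a b h => (hfe a b).2 (Quot.sound h)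
  have hF : Function.Bijective F := by
    constructor
    · intro x y h
      obtain ⟨a, rfl⟩ := Γ.proj_surjective e x
      obtain ⟨b, rfl⟩ := Γ.proj_surjective e y
      exact (hfe a b).1 h
    · intro y
      obtain ⟨a, rfl⟩ := hf y
      exact ⟨Γ.proj e a, rfl⟩
  let toV : Γ'.V ≃ (Γ.contract e).V := (Equiv.ofBijective F hF).symm
  let toH : Γ'.H ≃ (Γ.contract e).H :=
    Equiv.ofBijective (fun k => ⟨g k, (hge _).2 ⟨k, rfl⟩⟩) (by
      constructor
      · intro a b h
        exact hg (congrArg Subtype.val h)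
      · rintro ⟨h, hh⟩
        obtain ⟨k, rfl⟩ := (hge h).1 hh
        exact ⟨k, rfl⟩)
  have hb : ∀ k, toV (Γ'.bd k) = (Γ.contract e).bd (toH k) := fun k => by
    rw [Equiv.symm_apply_eq]
    exact (hbd k).symm
  { toV := toV
    toH := toH
    bd_comm := hb
    inv_comm := fun k => Subtype.ext (hinv k)
    wt_comm := wt_comm_of_chi toV toH hb fun y => by
      refine hchi _ _ fun a => ?_
      rw [Equiv.eq_symm_apply]
      rfl
    label_comm := fun l => hlabel l _ rfl }

variable (Γ : WGraph S)

/-- Splitting off a vertex of weight one and contracting the new edge gives back `Γ`. -/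
lemma exists_iso_contract_newEdge (v : Γ.V) (hv : 0 < Γ.wt v) (e : (Γ.expand v).Edge)
    (he : e = Γ.newEdge v) :
    ∃ φ : Iso Γ ((Γ.expand v).contract e), ∀ h, (φ.toH h).1 = Γ.oldH v h := by
  classical
  subst he
  let f : (Γ.expand v).V → Γ.V := fun x => Option.elim x v id
  have f_old : ∀ u, f (Γ.oldV v u) = u := fun _ => rfl
  have f_new : f (Γ.newV v) = v := rfl
  have hp : (Γ.expand v).proj (Γ.newEdge v) (Γ.newV v) =
      (Γ.expand v).proj (Γ.newEdge v) (Γ.oldV v v) :=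
    (Γ.expand v).proj_eq (Γ.newEdge v) (Γ.farH v) (Γ.far_mem_newEdge v)
  have hpf : ∀ a, (Γ.expand v).proj (Γ.newEdge v) a =
      (Γ.expand v).proj (Γ.newEdge v) (Γ.oldV v (f a)) := fun a => by
    induction a using expandV_cases with
    | new => exact hp
    | old u => rfl
  refine ⟨isoContract (Γ.newEdge v) f (Γ.oldH v) (fun u => ⟨Γ.oldV v u, rfl⟩) ?_
    (fun a b h => oldH_inj.1 h) ?_ (fun _ => rfl) (fun _ => rfl) ?_ ?_, fun _ => rfl⟩
  · intro a b
    constructor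
    · intro h
      rw [hpf a, hpf b, h]
    · intro h
      rw [mk_eq_iff] at h
      rcases h with rfl | ⟨h, hh, rfl, rfl⟩
      · rfl
      · rcases hh with rfl | rfl <;> rfl
  · intro h
    induction h using expandH_cases with
    | far => simp
    | near => simp
    | old h => simp
  · intro l l' h
    rw [← Γ.expand_label v l]
    congr 1
    exact Subtype.ext h
  · intro x y h
    rw [chi_contract]
    simp_rw [h]
    rw [Finset.sum_filter, sum_expandV]
    simp only [f_old, f_new, Finset.sum_ite_eq', Finset.mem_univ, if_true, expand_chi_new,
      Γ.expand_chi_old hv]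
    simp only [eq_comm (a := v)]
    ring

/-- Splitting off a vertex commutes with the contraction of the other edges. -/
lemma exists_iso_contract_oldEdge (v : Γ.V) (hv : 0 < Γ.wt v) (e : Γ.Edge)
    (e' : (Γ.expand v).Edge) (he : e' = Γ.oldEdge v e) :
    ∃ φ : Iso ((Γ.contract e).expand (Γ.proj e v)) ((Γ.expand v).contract e'),
      (φ.toH ((Γ.contract e).farH _)).1 = Γ.farH v ∧
      (φ.toH ((Γ.contract e).nearH _)).1 = Γ.nearH v ∧
      ∀ h, (φ.toH ((Γ.contract e).oldH _ h)).1 = Γ.oldH v h.1 := by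
  classical
  subst he
  set x := Γ.proj e v with hx
  have hwx : 0 < (Γ.contract e).wt x := hv.trans_le (wt_le_wt_proj e v)
  let f : (Γ.expand v).V → ((Γ.contract e).expand x).V := Option.map (Γ.proj e)
  have f_old : ∀ u, f (Γ.oldV v u) = (Γ.contract e).oldV x (Γ.proj e u) := fun _ => rfl
  have f_new : f (Γ.newV v) = (Γ.contract e).newV x := rfl
  let g : ((Γ.contract e).expand x).H → (Γ.expand v).H := Option.map (Option.map Subtype.val)
  have g_old : ∀ h, g ((Γ.contract e).oldH x h) = Γ.oldH v h.1 := fun _ => rfl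
  have g_near : g ((Γ.contract e).nearH x) = Γ.nearH v := rfl
  have g_far : g ((Γ.contract e).farH x) = Γ.farH v := rfl
  refine ⟨isoContract (Γ.oldEdge v e) f g ?_ ?_ ?_ ?_ ?_ ?_ ?_ ?_, rfl, rfl, fun _ => rfl⟩
  · intro y
    induction y using expandV_cases with
    | new => exact ⟨_, f_new⟩
    | old y =>
      obtain ⟨u, rfl⟩ := Γ.proj_surjective e y
      exact ⟨_, f_old u⟩
  · intro a b
    rw [mk_eq_iff]
    constructor
    · intro h
      induction a using expandV_cases with
      | new =>
        induction b using expandV_cases with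
        | new => exact Or.inl rfl
        | old b => exact absurd h (newV_ne_oldV _)
      | old a =>
        induction b using expandV_cases with
        | new => exact absurd h (oldV_ne_newV _)
        | old b =>
          rw [f_old, f_old, oldV_inj, mk_eq_iff] at h
          rcases h with rfl | ⟨h, hh, rfl, rfl⟩
          · exact Or.inl rfl
          · exact Or.inr ⟨Γ.oldH v h, (old_mem_oldEdge e h).2 hh, rfl, rfl⟩
    · rintro (rfl | ⟨_, ⟨h, hh, rfl⟩, rfl, rfl⟩)
      · rfl
      · rw [expand_inv_old, expand_bd_old, expand_bd_old, f_old, f_old, Γ.proj_eq e h hh]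
  · exact Option.map_injective (Option.map_injective Subtype.val_injective)
  · intro h
    induction h using expandH_cases with
    | far => exact iff_of_true (far_mem_oldEdge e) ⟨_, g_far⟩
    | near => exact iff_of_true (near_mem_oldEdge e) ⟨_, g_near⟩
    | old h =>
      rw [old_mem_oldEdge]
      constructor
      · intro hh
        exact ⟨_, g_old ⟨h, hh⟩⟩
      · rintro ⟨k, hk⟩
        induction k using expandH_cases with
        | far => exact absurd hk (farH_ne_oldH _)
        | near => exact absurd hk (nearH_ne_oldH _)
        | old k =>
          rw [g_old, oldH_inj] at hk
          exact hk ▸ k.2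
  · intro k
    induction k using expandH_cases <;> rfl
  · intro k
    induction k using expandH_cases <;> rfl
  · intro l l' h
    obtain ⟨l, rfl⟩ := ((Γ.contract e).legExpand x).surjective l
    obtain ⟨l', rfl⟩ := (Γ.legExpand v).surjective l'
    rw [expand_label, expand_label]
    rw [legExpand_coe, legExpand_coe, g_old, oldH_inj] at h
    obtain ⟨l, rfl⟩ := (Γ.legContract e).surjective l
    obtain rfl : l' = l := Subtype.ext h
    rfl
  · intro z y h
    rw [chi_contract]
    simp_rw [h]
    rw [Finset.sum_filter, sum_expandV]
    simp only [f_old, f_new]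
    induction y using expandV_cases with
    | new => simp [expand_chi_new]
    | old y =>
      rw [(Γ.contract e).expand_chi_old hwx, chi_contract, Finset.sum_filter]
      simp only [newV_ne_oldV, if_false, oldV_inj, zero_add, Γ.expand_chi_old hv]
      have : ∀ u, (if Γ.proj e u = y then Γ.chi u - (if u = v then 1 else 0) else 0) =
          (if Γ.proj e u = y then Γ.chi u else 0) -
            if u = v then (if y = x then 1 else 0) else 0 := by
        intro u
        by_cases hu : u = v
        · subst hu
          simp only [← hx, if_true, eq_comm (a := y)]
          split_ifs <;> simp
        · simp [hu]
      rw [Finset.sum_congr rfl fun u _ => this u, Finset.sum_sub_distrib]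
      simp

end WGraph

namespace WGraph

variable {S : Type u}

/-- A half-edge of `Γ` outside `e`, as a half-edge of `Γ/e`. -/
def contractH (Γ : WGraph S) (e : Γ.Edge) (h : Γ.H) (hh : h ∉ e.1) : (Γ.contract e).H := ⟨h, hh⟩

/-- Contracting the edge at a univalent vertex of weight one and then splitting off a vertex from
the resulting vertex gives back the graph. -/
lemma exists_iso_expand_contract (Γ : WGraph S) (v : Γ.V) (e : Γ.Edge) (h₀ : Γ.H) (hh : h₀ ∈ e.1)
    (hv : ∀ h, Γ.bd h = v ↔ h = h₀) (hw : Γ.wt v = 1) :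
    ∃ φ : Iso Γ ((Γ.contract e).expand (Γ.proj e v)),
      φ.toH h₀ = (Γ.contract e).farH _ ∧
      φ.toH (Γ.inv h₀) = (Γ.contract e).nearH _ ∧
      ∀ h (hh : h ∉ e.1), φ.toH h = (Γ.contract e).oldH _ (Γ.contractH e h hh) := by
  classical
  set x := Γ.proj e v with hx
  have hwx : 0 < (Γ.contract e).wt x := (by omega : 0 < Γ.wt v).trans_le (wt_le_wt_proj e v)
  have hne : Γ.inv h₀ ≠ h₀ := Γ.ne_of_mem_edge e hh
  have hv0 : Γ.bd h₀ = v := (hv _).2 rfl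
  have hmem : ∀ h, h ∈ e.1 ↔ h = h₀ ∨ h = Γ.inv h₀ := fun h => by
    rw [Γ.edge_eq_of_mem e hh]; rfl
  have hchi : Γ.chi v = 1 := by
    have : Γ.val v = 1 := by
      rw [val_eq_sum]
      simp [hv]
    unfold chi
    rw [this, hw]
    norm_num
  have hu : Γ.bd (Γ.inv h₀) ≠ v := fun H => hne ((hv _).1 H)
  have hglue : ∀ a b, Γ.Glue e a b → a = b ∨ a = v ∨ b = v := by
    rintro a b ⟨h, hh, rfl, rfl⟩
    rcases (hmem h).1 hh with rfl | rfl
    · exact Or.inr (Or.inl hv0)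
    · rw [Γ.inv_inv]
      exact Or.inr (Or.inr hv0)
  have hxu : x = Γ.proj e (Γ.bd (Γ.inv h₀)) := by
    rw [← Γ.proj_eq e h₀ hh, hv0]
  -- `v` becomes the new vertex, and its half-edge `h₀` the new half-edge attached to it.
  let f : Γ.V → ((Γ.contract e).expand x).V := fun a =>
    if a = v then (Γ.contract e).newV x else (Γ.contract e).oldV x (Γ.proj e a)
  have f_v : f v = (Γ.contract e).newV x := if_pos rfl
  have f_ne : ∀ {a}, a ≠ v → f a = (Γ.contract e).oldV x (Γ.proj e a) := fun h => if_neg h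
  let g : Γ.H → ((Γ.contract e).expand x).H := fun h =>
    if hh : h ∈ e.1 then
      (if h = h₀ then (Γ.contract e).farH x else (Γ.contract e).nearH x)
    else (Γ.contract e).oldH x (Γ.contractH e h hh)
  have g_far : g h₀ = (Γ.contract e).farH x := by
    simp only [g, dif_pos hh, if_true]
  have g_near : g (Γ.inv h₀) = (Γ.contract e).nearH x := by
    simp only [g, dif_pos ((Γ.inv_mem_edge e h₀).2 hh), if_neg hne]
  have g_old : ∀ {h} (hh : h ∉ e.1), g h = (Γ.contract e).oldH x (Γ.contractH e h hh) :=
    fun h => dif_neg h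
  have hcases : ∀ h, h = h₀ ∨ h = Γ.inv h₀ ∨ h ∉ e.1 := fun h => by
    rw [hmem]; tauto
  have hf : Function.Bijective f := by
    constructor
    · intro a b h
      by_cases ha : a = v <;> by_cases hb : b = v
      · rw [ha, hb]
      · rw [ha, f_v, f_ne hb] at h
        exact absurd h (newV_ne_oldV _)
      · rw [hb, f_v, f_ne ha] at h
        exact absurd h (oldV_ne_newV _)
      · rw [f_ne ha, f_ne hb, oldV_inj, mk_eq_iff] at h
        rcases h with h | h
        · exact h
        · rcases hglue a b h with h | h | h
          · exact h
          · exact absurd h ha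
          · exact absurd h hb
    · intro y
      induction y using expandV_cases with
      | new => exact ⟨v, f_v⟩
      | old y =>
        obtain ⟨a, rfl⟩ := Γ.proj_surjective e y
        by_cases ha : a = v
        · refine ⟨Γ.bd (Γ.inv h₀), ?_⟩
          rw [f_ne hu, ha, ← hxu]
        · exact ⟨a, f_ne ha⟩
  have hg : Function.Bijective g := by
    constructor
    · intro a b h
      rcases hcases a with rfl | rfl | ha <;> rcases hcases b with rfl | rfl | hb
      · rfl
      · rw [g_far, g_near] at h
        exact absurd h (farH_ne_nearH _ _)
      · rw [g_far, g_old hb] at h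
        exact absurd h (farH_ne_oldH _)
      · rw [g_far, g_near] at h
        exact absurd h (nearH_ne_farH _ _)
      · rfl
      · rw [g_near, g_old hb] at h
        exact absurd h (nearH_ne_oldH _)
      · rw [g_far, g_old ha] at h
        exact absurd h (oldH_ne_farH _)
      · rw [g_near, g_old ha] at h
        exact absurd h (oldH_ne_nearH _)
      · rw [g_old ha, g_old hb, oldH_inj] at h
        exact congrArg Subtype.val h
    · intro y
      induction y using expandH_cases with
      | far => exact ⟨_, g_far⟩
      | near => exact ⟨_, g_near⟩
      | old y => exact ⟨y.1, g_old y.2⟩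
  let toV := Equiv.ofBijective f hf
  let toH := Equiv.ofBijective g hg
  have hb : ∀ k, toV (Γ.bd k) = ((Γ.contract e).expand x).bd (toH k) := by
    intro k
    change f (Γ.bd k) = ((Γ.contract e).expand x).bd (g k)
    rcases hcases k with rfl | rfl | hk
    · rw [g_far, hv0, f_v, expand_bd_far]
    · rw [g_near, f_ne hu, expand_bd_near, hxu]
    · have : Γ.bd k ≠ v := fun H => hk ((hv k).1 H ▸ hh)
      rw [g_old hk, f_ne this, expand_bd_old, contract_bd]
      rfl
  refine ⟨{ toV := toV, toH := toH, bd_comm := hb, inv_comm := ?_, wt_comm := ?_,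
            label_comm := ?_ }, g_far, g_near, fun h hh => g_old hh⟩
  · intro k
    change g (Γ.inv k) = ((Γ.contract e).expand x).inv (g k)
    rcases hcases k with rfl | rfl | hk
    · rw [g_far, g_near, expand_inv_far]
    · rw [Γ.inv_inv, g_far, g_near, expand_inv_near]
    · rw [g_old hk, g_old fun H => hk ((Γ.inv_mem_edge e k).1 H), expand_inv_old]
      rfl
  · refine wt_comm_of_chi toV toH hb fun a => ?_
    change ((Γ.contract e).expand x).chi (f a) = _
    by_cases ha : a = v
    · rw [ha, f_v, expand_chi_new, hchi]
    · rw [f_ne ha, (Γ.contract e).expand_chi_old hwx, chi_contract]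
      have hfib : ∀ b, Γ.proj e b = Γ.proj e a ↔ b = a ∨ (b = v ∧ Γ.proj e a = x) := by
        intro b
        constructor
        · intro h
          rcases (Γ.mk_eq_iff e b a).1 h with h' | h'
          · exact Or.inl h'
          · rcases hglue b a h' with h' | h' | h'
            · exact Or.inl h'
            · subst h'
              exact Or.inr ⟨rfl, h.symm⟩
            · exact absurd h' ha
        · rintro (rfl | ⟨rfl, h⟩)
          · rfl
          · exact h.symm
      simp_rw [hfib]
      by_cases hax : Γ.proj e a = x
      · simp only [hax, and_true, if_true]
        rw [Finset.sum_congr (s₂ := {a, v}) (by ext; simp) fun _ _ => rfl, Finset.sum_pair ha,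
          hchi, add_sub_cancel_right]
      · rw [Finset.sum_congr (s₂ := {a}) (by ext; simp [hax]) fun _ _ => rfl,
          Finset.sum_singleton, if_neg hax, sub_zero]
  · intro l
    have hl : l.1 ∉ e.1 := fun H => Γ.ne_of_mem_edge e H l.2
    rw [show Γ.label l = (Γ.contract e).label (Γ.legContract e l) from rfl,
      ← (Γ.contract e).expand_label x]
    congr 1
    exact Subtype.ext (g_old hl)

/-- An isomorphism which sends `v` to `v'` extends to the graphs obtained by splitting off a vertex
from `v` and `v'`. -/
lemma Iso.exists_expand {Γ Γ' : WGraph S} (φ : Iso Γ Γ') (v : Γ.V) (v' : Γ'.V)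
    (hv : φ.toV v = v') :
    ∃ ψ : Iso (Γ.expand v) (Γ'.expand v'),
      ψ.toH (Γ.farH v) = Γ'.farH v' ∧ ψ.toH (Γ.nearH v) = Γ'.nearH v' ∧
      ∀ h, ψ.toH (Γ.oldH v h) = Γ'.oldH v' (φ.toH h) := by
  subst hv
  refine ⟨{ toV := φ.toV.optionCongr, toH := φ.toH.optionCongr.optionCongr, bd_comm := ?_,
            inv_comm := ?_, wt_comm := ?_, label_comm := ?_ }, rfl, rfl, fun _ => rfl⟩
  · intro h
    induction h using expandH_cases with
    | far => rfl
    | near => rfl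
    | old h => exact congrArg some (φ.bd_comm h)
  · intro h
    induction h using expandH_cases with
    | far => rfl
    | near => rfl
    | old h => exact congrArg (fun k => some (some k)) (φ.inv_comm h)
  · intro x
    induction x using expandV_cases with
    | new => rfl
    | old u =>
      change (Γ'.expand _).wt (Γ'.oldV _ (φ.toV u)) = _
      rw [expand_wt_old, expand_wt_old, φ.wt_comm]
      by_cases hu : u = v
      · rw [if_pos (congrArg _ hu), if_pos hu]
      · rw [if_neg fun H => hu (φ.toV.injective H), if_neg hu]
  · intro l
    obtain ⟨l, rfl⟩ := (Γ.legExpand v).surjective l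
    rw [expand_label, ← φ.label_comm l, ← Γ'.expand_label (φ.toV v)]
    rfl

lemma Iso.admissible {Γ Γ' : WGraph S} (φ : Iso Γ Γ') (h : Γ.Admissible) : Γ'.Admissible := by
  rw [admissible_iff] at h ⊢
  intro v
  obtain ⟨v, rfl⟩ := φ.toV.surjective v
  rw [φ.chi_comm]
  exact h v

lemma Iso.connected {Γ Γ' : WGraph S} (φ : Iso Γ Γ') (h : Γ.Connected) : Γ'.Connected := by
  obtain ⟨⟨v⟩, h⟩ := h
  refine ⟨⟨φ.toV v⟩, fun a b => ?_⟩
  obtain ⟨a, rfl⟩ := φ.toV.surjective a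
  obtain ⟨b, rfl⟩ := φ.toV.surjective b
  refine (h a b).lift φ.toV ?_
  rintro _ _ ⟨h, rfl, rfl⟩
  exact ⟨φ.toH h, (φ.bd_comm h).symm, by rw [← φ.inv_comm, φ.bd_comm]⟩

/-- The inverse of an isomorphism. -/
def Iso.symm {Γ Γ' : WGraph S} (φ : Iso Γ Γ') : Iso Γ' Γ where
  toV := φ.toV.symm
  toH := φ.toH.symm
  bd_comm h := by rw [Equiv.symm_apply_eq, φ.bd_comm, Equiv.apply_symm_apply]
  inv_comm h := by rw [Equiv.symm_apply_eq, φ.inv_comm, Equiv.apply_symm_apply]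
  wt_comm v := by rw [← φ.wt_comm, Equiv.apply_symm_apply]
  label_comm l := by
    rw [← φ.label_comm]
    congr 1
    exact Subtype.ext (φ.toH.apply_symm_apply _)

lemma Iso.sum_chi {Γ Γ' : WGraph S} (φ : Iso Γ Γ') : ∑ v, Γ'.chi v = ∑ v, Γ.chi v :=
  (Fintype.sum_equiv φ.toV _ _ fun v => (φ.chi_comm v).symm).symm

end WGraph

/-! ### The splitting operator -/

namespace GE

variable {S : Type u} (n : ℕ)

/-- A linear map out of `G^{E_n}(S)`, given by its values on oriented graphs. -/
noncomputable def lift {M : Type*} [AddCommGroup M] [Module ℚ M] (f : OrientedGraph S → M)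
    (hiso : ∀ (Γ Γ' : BlackGraph S) (φ : WGraph.Iso Γ.toWGraph Γ'.toWGraph) (k : ℕ)
      (ν : Fin k ≃ Γ.Edge) (ω : Fin (Nat.card S) ≃ Γ.Leg),
      f ⟨Γ', k, ν.trans φ.edgeEquiv, ω.trans φ.legEquiv⟩ = f ⟨Γ, k, ν, ω⟩)
    (hedges : ∀ (Γ : BlackGraph S) (k : ℕ) (ν : Fin k ≃ Γ.Edge) (ω : Fin (Nat.card S) ≃ Γ.Leg)
      (σ : Equiv.Perm (Fin k)),
      f ⟨Γ, k, σ.trans ν, ω⟩ = ((Equiv.Perm.sign σ : ℤ) : ℚ) • f ⟨Γ, k, ν, ω⟩)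
    (hlegs : ∀ (Γ : BlackGraph S) (k : ℕ) (ν : Fin k ≃ Γ.Edge) (ω : Fin (Nat.card S) ≃ Γ.Leg)
      (τ : Equiv.Perm (Fin (Nat.card S))),
      f ⟨Γ, k, ν, τ.trans ω⟩ = ((Equiv.Perm.sign τ : ℤ) : ℚ) ^ n • f ⟨Γ, k, ν, ω⟩) :
    GE n S →ₗ[ℚ] M :=
  Submodule.liftQ _ (Finsupp.linearCombination ℚ f) (by
    rw [Submodule.span_le]
    intro x hx
    cases hx with
    | iso Γ Γ' φ k ν ω => simp [hiso]
    | edges Γ k ν ω σ => simp [hedges]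
    | legs Γ k ν ω τ => simp [hlegs])

@[simp] lemma lift_cls {M : Type*} [AddCommGroup M] [Module ℚ M] (f : OrientedGraph S → M)
    (hiso hedges hlegs) (A : OrientedGraph S) :
    lift n f hiso hedges hlegs (cls n A) = f A := by
  simp [lift, cls, Submodule.liftQ_apply]

open Classical in
/-- The class in `G^{E_n}(S)` of a graph with orderings of its edges and legs, which is `0` if the
graph is not admissible or not connected. -/
noncomputable def clsOrZero (Γ : WGraph S) (k : ℕ) (ν : Fin k ≃ Γ.Edge)
    (ω : Fin (Nat.card S) ≃ Γ.Leg) : GE n S :=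
  if h : Γ.Admissible ∧ Γ.Connected then cls n ⟨⟨Γ, h.1, h.2⟩, k, ν, ω⟩ else 0

lemma clsOrZero_of_pos {Γ : WGraph S} (ha : Γ.Admissible) (hc : Γ.Connected) {k : ℕ}
    (ν : Fin k ≃ Γ.Edge) (ω : Fin (Nat.card S) ≃ Γ.Leg) :
    clsOrZero n Γ k ν ω = cls n ⟨⟨Γ, ha, hc⟩, k, ν, ω⟩ := dif_pos ⟨ha, hc⟩

lemma clsOrZero_of_neg {Γ : WGraph S} (ha : ¬ Γ.Admissible) {k : ℕ}
    (ν : Fin k ≃ Γ.Edge) (ω : Fin (Nat.card S) ≃ Γ.Leg) :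
    clsOrZero n Γ k ν ω = 0 := dif_neg fun h => ha h.1

lemma clsOrZero_iso {Γ Γ' : WGraph S} (φ : WGraph.Iso Γ Γ') {k : ℕ}
    {ν : Fin k ≃ Γ.Edge} {ω : Fin (Nat.card S) ≃ Γ.Leg}
    {ν' : Fin k ≃ Γ'.Edge} {ω' : Fin (Nat.card S) ≃ Γ'.Leg}
    (hν : ∀ i h, h ∈ (ν i).1 ↔ φ.toH h ∈ (ν' i).1)
    (hω : ∀ i, φ.toH (ω i).1 = (ω' i).1) :
    clsOrZero n Γ' k ν' ω' = clsOrZero n Γ k ν ω := by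
  by_cases h : Γ.Admissible ∧ Γ.Connected
  · rw [clsOrZero_of_pos n h.1 h.2, clsOrZero_of_pos n (φ.admissible h.1) (φ.connected h.2)]
    exact cls_iso n (Γ := ⟨Γ, h.1, h.2⟩) (Γ' := ⟨Γ', _, _⟩) φ hν hω
  · have h' : ¬ (Γ'.Admissible ∧ Γ'.Connected) := fun H =>
      h ⟨φ.symm.admissible H.1, φ.symm.connected H.2⟩
    rw [clsOrZero, clsOrZero, dif_neg h, dif_neg h']

lemma clsOrZero_edges (Γ : WGraph S) (k : ℕ) (ν : Fin k ≃ Γ.Edge) (ω : Fin (Nat.card S) ≃ Γ.Leg)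
    (σ : Equiv.Perm (Fin k)) :
    clsOrZero n Γ k (σ.trans ν) ω = ((Equiv.Perm.sign σ : ℤ) : ℚ) • clsOrZero n Γ k ν ω := by
  unfold clsOrZero
  split_ifs with h
  · exact cls_edges n ⟨Γ, h.1, h.2⟩ k ν ω σ
  · rw [smul_zero]

lemma clsOrZero_legs (Γ : WGraph S) (k : ℕ) (ν : Fin k ≃ Γ.Edge) (ω : Fin (Nat.card S) ≃ Γ.Leg)
    (τ : Equiv.Perm (Fin (Nat.card S))) :
    clsOrZero n Γ k ν (τ.trans ω) =
      ((Equiv.Perm.sign τ : ℤ) : ℚ) ^ n • clsOrZero n Γ k ν ω := by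
  unfold clsOrZero
  split_ifs with h
  · exact cls_legs n ⟨Γ, h.1, h.2⟩ k ν ω τ
  · rw [smul_zero]

/-- The oriented graph obtained by splitting off a vertex from `v`, the new edge being the first
one. It is `0` if the result is not admissible; if `Γ` is admissible and `v` has positive weight,
this happens only when `v` is univalent of weight `1`. -/
noncomputable def splitTerm (Γ : WGraph S) {k : ℕ} (ν : Fin k ≃ Γ.Edge)
    (ω : Fin (Nat.card S) ≃ Γ.Leg) (v : Γ.V) : GE n S :=
  clsOrZero n (Γ.expand v) (k + 1) (Γ.expandOrder v ν) (ω.trans (Γ.legExpand v))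

/-- The sum over all vertices `v` of `w(v)` times the graph obtained by splitting off a vertex
from `v`. -/
noncomputable def splitGen (A : OrientedGraph S) : GE n S :=
  ∑ v, (A.graph.wt v : ℚ) • splitTerm n A.graph.toWGraph A.ν A.ω v

lemma mem_expandOrder_iff {Γ Γ' : WGraph S} {v : Γ.V} {v' : Γ'.V} {k : ℕ} (ν : Fin k ≃ Γ.Edge)
    (ν' : Fin k ≃ Γ'.Edge) (f : Γ.H → Γ'.H) (hν : ∀ i h, h ∈ (ν i).1 ↔ f h ∈ (ν' i).1)
    (g : (Γ.expand v).H → (Γ'.expand v').H) (hfar : g (Γ.farH v) = Γ'.farH v')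
    (hnear : g (Γ.nearH v) = Γ'.nearH v') (hold : ∀ h, g (Γ.oldH v h) = Γ'.oldH v' (f h))
    (i : Fin (k + 1)) (h : (Γ.expand v).H) :
    h ∈ (Γ.expandOrder v ν i).1 ↔ g h ∈ (Γ'.expandOrder v' ν' i).1 := by
  induction i using Fin.cases with
  | zero =>
    rw [Γ.expandOrder_zero, Γ'.expandOrder_zero]
    induction h using WGraph.expandH_cases with
    | far => rw [hfar]; exact iff_of_true (Γ.far_mem_newEdge v) (Γ'.far_mem_newEdge v')
    | near => rw [hnear]; exact iff_of_true (Γ.near_mem_newEdge v) (Γ'.near_mem_newEdge v')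
    | old h => rw [hold]; exact iff_of_false (WGraph.old_mem_newEdge _) (WGraph.old_mem_newEdge _)
  | succ i =>
    rw [Γ.expandOrder_succ, Γ'.expandOrder_succ]
    induction h using WGraph.expandH_cases with
    | far => rw [hfar]; exact iff_of_false (WGraph.far_mem_oldEdge _) (WGraph.far_mem_oldEdge _)
    | near =>
      rw [hnear]; exact iff_of_false (WGraph.near_mem_oldEdge _) (WGraph.near_mem_oldEdge _)
    | old h =>
      rw [hold]
      exact (WGraph.old_mem_oldEdge _ _).trans ((hν i h).trans (WGraph.old_mem_oldEdge _ _).symm)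

lemma splitTerm_iso {Γ Γ' : WGraph S} (φ : WGraph.Iso Γ Γ') (k : ℕ)
    (ν : Fin k ≃ Γ.Edge) (ω : Fin (Nat.card S) ≃ Γ.Leg) (v : Γ.V) :
    splitTerm n Γ' (ν.trans φ.edgeEquiv) (ω.trans φ.legEquiv) (φ.toV v) =
      splitTerm n Γ ν ω v := by
  obtain ⟨ψ, h1, h2, h3⟩ := φ.exists_expand v _ rfl
  refine clsOrZero_iso n ψ ?_ ?_
  · exact mem_expandOrder_iff _ _ φ.toH (fun i h => (φ.mem_edgeEquiv (ν i) h).symm) _ h1 h2 h3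
  · exact fun i => h3 _

lemma splitTerm_edges (Γ : WGraph S) (k : ℕ) (ν : Fin k ≃ Γ.Edge) (ω : Fin (Nat.card S) ≃ Γ.Leg)
    (σ : Equiv.Perm (Fin k)) (v : Γ.V) :
    splitTerm n Γ (σ.trans ν) ω v =
      ((Equiv.Perm.sign σ : ℤ) : ℚ) • splitTerm n Γ ν ω v := by
  have h : Γ.expandOrder v (σ.trans ν) =
      (Equiv.Perm.decomposeFin.symm (0, σ)).trans (Γ.expandOrder v ν) := by
    ext i : 1
    induction i using Fin.cases with
    | zero => simp [WGraph.expandOrder_zero]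
    | succ i => simp [WGraph.expandOrder_succ]
  rw [splitTerm, h, clsOrZero_edges, Equiv.Perm.decomposeFin.symm_sign, if_pos rfl, one_mul]
  rfl

lemma splitTerm_legs (Γ : WGraph S) (k : ℕ) (ν : Fin k ≃ Γ.Edge) (ω : Fin (Nat.card S) ≃ Γ.Leg)
    (τ : Equiv.Perm (Fin (Nat.card S))) (v : Γ.V) :
    splitTerm n Γ ν (τ.trans ω) v =
      ((Equiv.Perm.sign τ : ℤ) : ℚ) ^ n • splitTerm n Γ ν ω v :=
  clsOrZero_legs n _ _ _ (ω.trans (Γ.legExpand v)) τ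

/-- The operator which splits off vertices of weight one, the contracting homotopy up to terms of
higher total weight. -/
noncomputable def split : GE n S →ₗ[ℚ] GE n S :=
  lift n (splitGen n)
    (fun Γ Γ' φ k ν ω => by
      unfold splitGen
      refine (Fintype.sum_equiv φ.toV _ _ fun v => ?_).symm
      rw [φ.wt_comm, splitTerm_iso])
    (fun Γ k ν ω σ => by
      simp only [splitGen, splitTerm_edges, Finset.smul_sum]
      exact Finset.sum_congr rfl fun v _ => smul_comm _ _ _)
    (fun Γ k ν ω τ => by
      simp only [splitGen, splitTerm_legs, Finset.smul_sum]
      exact Finset.sum_congr rfl fun v _ => smul_comm _ _ _)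

lemma split_cls (A : OrientedGraph S) : split n (cls n A) = splitGen n A := lift_cls ..

/-- The term of the differential which contracts the new edge. -/
lemma contract_newEdge_term (Γ : BlackGraph S) {k : ℕ} (ν : Fin k ≃ Γ.Edge)
    (ω : Fin (Nat.card S) ≃ Γ.Leg) (v : Γ.V) (hv : 0 < Γ.wt v)
    (hadm : (Γ.expand v).Admissible) (hconn : (Γ.expand v).Connected) :
    cls n (contractTerm ⟨Γ.expand v, hadm, hconn⟩ (Γ.expandOrder v ν)
      (ω.trans (Γ.legExpand v)) 0) = cls n ⟨Γ, k, ν, ω⟩ := by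
  obtain ⟨φ, hφ⟩ := Γ.exists_iso_contract_newEdge v hv _ (Γ.expandOrder_zero v ν)
  refine cls_iso n (Γ := Γ) (Γ' := BlackGraph.contract ⟨Γ.expand v, hadm, hconn⟩ _) φ ?_ ?_
  · intro i h
    refine Iff.trans ?_ ((Γ.expand v).mem_contractOrder (Γ.expandOrder v ν) 0 i _).symm
    have hmem : ∀ x, x = Γ.oldH v h →
        (h ∈ (ν i).1 ↔ x ∈ (Γ.expandOrder v ν (Fin.succAbove 0 i)).1) := by
      rintro _ rfl
      rw [Fin.zero_succAbove, Γ.expandOrder_succ]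
      exact (WGraph.old_mem_oldEdge _ _).symm
    exact hmem _ (hφ h)
  · exact fun i => Subtype.ext (hφ _)

/-- The terms of the differential which contract an old edge. -/
lemma contract_oldEdge_term (Γ : BlackGraph S) {k : ℕ} (ν : Fin (k + 1) ≃ Γ.Edge)
    (ω : Fin (Nat.card S) ≃ Γ.Leg) (v : Γ.V) (hv : 0 < Γ.wt v)
    (hadm : (Γ.expand v).Admissible) (hconn : (Γ.expand v).Connected) (i : Fin (k + 1)) :
    cls n (contractTerm ⟨Γ.expand v, hadm, hconn⟩ (Γ.expandOrder v ν)
      (ω.trans (Γ.legExpand v)) i.succ) =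
    splitTerm n (Γ.toWGraph.contract (ν i)) (Γ.contractOrder ν i) (ω.trans (Γ.legContract (ν i)))
      (Γ.proj (ν i) v) := by
  obtain ⟨φ, h1, h2, h3⟩ :=
    Γ.exists_iso_contract_oldEdge v hv (ν i) _ (Γ.expandOrder_succ v ν i)
  have := clsOrZero_of_pos n (hadm.contract (Γ.expandOrder v ν i.succ))
    (hconn.contract (Γ.expandOrder v ν i.succ))
    ((Γ.expand v).contractOrder (Γ.expandOrder v ν) i.succ)
    ((ω.trans (Γ.legExpand v)).trans ((Γ.expand v).legContract _))
  refine this.symm.trans (clsOrZero_iso n φ ?_ ?_)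
  · intro j h
    refine Iff.trans ?_ ((Γ.expand v).mem_contractOrder (Γ.expandOrder v ν) i.succ j _).symm
    induction j using Fin.cases with
    | zero =>
      rw [Fin.succ_succAbove_zero, Γ.expandOrder_zero, WGraph.expandOrder_zero]
      induction h using WGraph.expandH_cases with
      | far => rw [h1]; exact iff_of_true (WGraph.far_mem_newEdge _ _) (Γ.far_mem_newEdge v)
      | near => rw [h2]; exact iff_of_true (WGraph.near_mem_newEdge _ _) (Γ.near_mem_newEdge v)
      | old h =>
        rw [h3]; exact iff_of_false (WGraph.old_mem_newEdge _) (WGraph.old_mem_newEdge _)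
    | succ j =>
      rw [Fin.succ_succAbove_succ, Γ.expandOrder_succ, WGraph.expandOrder_succ]
      induction h using WGraph.expandH_cases with
      | far => rw [h1]; exact iff_of_false (WGraph.far_mem_oldEdge _) (WGraph.far_mem_oldEdge _)
      | near =>
        rw [h2]; exact iff_of_false (WGraph.near_mem_oldEdge _) (WGraph.near_mem_oldEdge _)
      | old h =>
        rw [h3]
        exact (WGraph.old_mem_oldEdge _ h).trans ((Γ.mem_contractOrder ν i j h).trans
          (WGraph.old_mem_oldEdge (ν (i.succAbove j)) h.1).symm)
  · exact fun j => Subtype.ext (h3 _)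

/-- Contracting the edge at a univalent vertex of weight one and splitting off a vertex from the
result only moves that edge to the front of the ordering. -/
lemma splitTerm_contract_of_leaf (Γ : BlackGraph S) {k : ℕ} (ν : Fin (k + 1) ≃ Γ.Edge)
    (ω : Fin (Nat.card S) ≃ Γ.Leg) (v : Γ.V) (i : Fin (k + 1)) (h₀ : Γ.H) (hh : h₀ ∈ (ν i).1)
    (hv : ∀ h, Γ.bd h = v ↔ h = h₀) (hw : Γ.wt v = 1) :
    splitTerm n (Γ.toWGraph.contract (ν i)) (Γ.contractOrder ν i) (ω.trans (Γ.legContract (ν i)))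
      (Γ.proj (ν i) v) = (-1 : ℚ) ^ (i : ℕ) • cls n ⟨Γ, k + 1, ν, ω⟩ := by
  obtain ⟨φ, h1, h2, h3⟩ := Γ.exists_iso_expand_contract v (ν i) h₀ hh hv hw
  have hs := cls_edges n Γ (k + 1) ν ω i.cycleRange.symm
  rw [Equiv.Perm.sign_symm, Fin.sign_cycleRange] at hs
  push_cast at hs
  rw [← hs, ← clsOrZero_of_pos n Γ.admissible Γ.connected (i.cycleRange.symm.trans ν) ω]
  refine clsOrZero_iso n φ ?_ ?_
  · intro j h
    have hcases : h = h₀ ∨ h = Γ.inv h₀ ∨ h ∉ (ν i).1 := by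
      have : h ∈ (ν i).1 ↔ h = h₀ ∨ h = Γ.inv h₀ := by
        rw [Γ.edge_eq_of_mem (ν i) hh]; rfl
      rw [this]; tauto
    have hh' := (Γ.inv_mem_edge (ν i) h₀).2 hh
    induction j using Fin.cases with
    | zero =>
      rw [WGraph.expandOrder_zero, Equiv.trans_apply, Fin.cycleRange_symm_zero]
      rcases hcases with rfl | rfl | hn
      · rw [h1]; exact iff_of_true hh (WGraph.far_mem_newEdge _ _)
      · rw [h2]; exact iff_of_true hh' (WGraph.near_mem_newEdge _ _)
      · rw [h3 h hn]; exact iff_of_false hn (WGraph.old_mem_newEdge _)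
    | succ j =>
      rw [WGraph.expandOrder_succ, Equiv.trans_apply, Fin.cycleRange_symm_succ]
      have hne : ν i ≠ ν (i.succAbove j) := fun H => Fin.succAbove_ne i j (ν.injective H).symm
      rcases hcases with rfl | rfl | hn
      · rw [h1]
        exact iff_of_false (fun H => hne (WGraph.edge_eq hh H)) (WGraph.far_mem_oldEdge _)
      · rw [h2]
        exact iff_of_false (fun H => hne (WGraph.edge_eq hh' H)) (WGraph.near_mem_oldEdge _)
      · rw [h3 h hn]
        exact (Γ.mem_contractOrder ν i j (Γ.contractH (ν i) h hn)).symm.trans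
          (WGraph.old_mem_oldEdge (Γ.contractOrder ν i j) (Γ.contractH (ν i) h hn)).symm
  · exact fun j => h3 _ fun H => Γ.ne_of_mem_edge (ν i) H (ω j).2

end GE

namespace WGraph

variable {S : Type u} {Γ : WGraph S}

/-- In a connected graph with `∑ (2 w + val - 2) ≥ 2`, a vertex of positive weight for which
`2 w + val - 2` is `1` is univalent, and its half-edge is not a leg: otherwise it would be the only
vertex. -/
lemma Connected.exists_leaf (hΓ : Γ.Connected) (h2 : 2 ≤ ∑ u, Γ.chi u) {v : Γ.V}
    (hv : 0 < Γ.wt v) (hadm : 1 ≤ Γ.chi v) (hc : ¬ 2 ≤ Γ.chi v) :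
    Γ.wt v = 1 ∧ ∃ h₀, (∀ h, Γ.bd h = v ↔ h = h₀) ∧ Γ.inv h₀ ≠ h₀ := by
  classical
  have hall : (∀ h, Γ.bd h = v → Γ.bd (Γ.inv h) = v) → False := by
    intro H
    have huniv : ∀ u, u = v := by
      intro u
      induction hΓ.2 v u with
      | refl => rfl
      | tail _ hbc ih =>
        obtain ⟨h, h1, rfl⟩ := hbc
        exact H h (h1.trans ih)
    have : ∑ u, Γ.chi u = Γ.chi v := by
      rw [Finset.sum_congr (s₂ := {v}) (by ext u; simp [huniv u]) fun _ _ => rfl,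
        Finset.sum_singleton]
    omega
  have hval : Γ.val v = 1 := by
    have h0 : Γ.val v ≠ 0 := by
      intro H
      rw [val, Finset.card_eq_zero, Finset.filter_eq_empty_iff] at H
      exact hall fun h hh => absurd hh (H (Finset.mem_univ h))
    unfold chi at hc hadm
    omega
  refine ⟨by unfold chi at hc hadm; omega, ?_⟩
  rw [val, Finset.card_eq_one] at hval
  obtain ⟨h₀, hh₀⟩ := hval
  have hiff : ∀ h, Γ.bd h = v ↔ h = h₀ := fun h => by
    simpa using Finset.ext_iff.1 hh₀ h
  refine ⟨h₀, hiff, fun H => hall fun h hh => ?_⟩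
  rw [(hiff h).1 hh, H]
  exact (hiff _).2 rfl

open Classical in
lemma totalWt_contract (e : Γ.Edge) :
    (Γ.contract e).totalWt = Γ.totalWt +
      ∑ x, if Γ.IsLoop e ∧ ∃ h ∈ e.1, Γ.proj e (Γ.bd h) = x then 1 else 0 := by
  unfold totalWt
  simp_rw [contract_wt]
  rw [Finset.sum_add_distrib]
  congr 1
  exact Finset.sum_fiberwise _ _ _

end WGraph

/-! ### The homotopy formula -/

namespace GE

variable {S : Type u} (n : ℕ)

/-- The span of the graphs of internal degree `q`, total degree `m` and total weight at least
`j`. -/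
noncomputable def weightFiltration (n : ℕ) (S : Type u) (q m : ℤ) (j : ℕ) :
    Submodule ℚ (GE n S) :=
  Submodule.span ℚ {x | ∃ A : OrientedGraph S, A.graph.degInt n = q ∧
    A.graph.degInt n + A.numEdges = m ∧ j ≤ A.graph.totalWt ∧ cls n A = x}

lemma smul_splitTerm_mem (Γ : WGraph S) {k : ℕ} (ν : Fin k ≃ Γ.Edge)
    (ω : Fin (Nat.card S) ≃ Γ.Leg) (v : Γ.V) {q m m' : ℤ} {j : ℕ}
    (hq : (n : ℤ) * ∑ u, Γ.chi u = q) (hm : q + k = m') (hm' : m' + 1 = m)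
    (hj : j ≤ Γ.totalWt) (c : ℚ) (hc : Γ.wt v = 0 → c = 0) :
    c • splitTerm n Γ ν ω v ∈ weightFiltration n S q m j := by
  rcases Nat.eq_zero_or_pos (Γ.wt v) with hv | hv
  · rw [hc hv, zero_smul]
    exact Submodule.zero_mem _
  refine Submodule.smul_mem _ _ ?_
  unfold splitTerm clsOrZero
  split_ifs with h
  · refine Submodule.subset_span ⟨_, ?_, ?_, ?_, rfl⟩
    · exact (congrArg (fun x => (n : ℤ) * x) (Γ.sum_chi_expand hv)).trans hq
    · have : (n : ℤ) * ∑ u, (Γ.expand v).chi u = q :=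
        (congrArg (fun x => (n : ℤ) * x) (Γ.sum_chi_expand hv)).trans hq
      change (n : ℤ) * ∑ u, (Γ.expand v).chi u + ((k + 1 : ℕ) : ℤ) = m
      push_cast
      omega
    · exact hj.trans (Γ.totalWt_expand hv).ge
  · exact Submodule.zero_mem _

lemma splitTerm_of_chi_le {Γ : WGraph S} {k : ℕ} (ν : Fin k ≃ Γ.Edge)
    (ω : Fin (Nat.card S) ≃ Γ.Leg) {v : Γ.V} (hv : 0 < Γ.wt v) (hc : ¬ 2 ≤ Γ.chi v) :
    splitTerm n Γ ν ω v = 0 :=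
  clsOrZero_of_neg n (fun h => hc (Γ.two_le_chi_of_admissible_expand hv h)) _ _

lemma d_splitTerm_of_noEdges (Γ : BlackGraph S) (ν : Fin 0 ≃ Γ.Edge)
    (ω : Fin (Nat.card S) ≃ Γ.Leg) (v : Γ.V) (hv : 0 < Γ.wt v) (h2 : 2 ≤ ∑ u, Γ.chi u) :
    d n (splitTerm n Γ.toWGraph ν ω v) = cls n ⟨Γ, 0, ν, ω⟩ := by
  have hc : 2 ≤ Γ.chi v := by
    by_contra hc
    obtain ⟨-, h₀, -, hh⟩ := Γ.connected.exists_leaf h2 hv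
      (WGraph.admissible_iff.1 Γ.admissible v) hc
    exact (ν.symm ⟨_, h₀, hh, rfl⟩).elim0
  have hadm := Γ.admissible.expand hv hc
  rw [splitTerm, clsOrZero_of_pos n hadm (Γ.connected.expand v), d_cls]
  simp only [dGen]
  refine (Fin.sum_univ_one _).trans ?_
  rw [Fin.val_zero, pow_zero, one_smul]
  exact contract_newEdge_term n Γ ν ω v hv hadm _

/-- Splitting off a vertex from `v` is a contracting homotopy: its commutator with the differential
is the identity. If `v` is a univalent vertex of weight `1`, the identity comes from the
contraction of the edge at `v`; otherwise it comes from the contraction of the new edge. -/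
lemma d_splitTerm (Γ : BlackGraph S) {k : ℕ} (ν : Fin (k + 1) ≃ Γ.Edge)
    (ω : Fin (Nat.card S) ≃ Γ.Leg) (v : Γ.V) (hv : 0 < Γ.wt v) (h2 : 2 ≤ ∑ u, Γ.chi u) :
    d n (splitTerm n Γ.toWGraph ν ω v) + ∑ i : Fin (k + 1), (-1 : ℚ) ^ (i : ℕ) •
      splitTerm n (Γ.toWGraph.contract (ν i)) (Γ.contractOrder ν i)
        (ω.trans (Γ.legContract (ν i))) (Γ.proj (ν i) v) = cls n ⟨Γ, k + 1, ν, ω⟩ := by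
  by_cases hc : 2 ≤ Γ.chi v
  · have hadm := Γ.admissible.expand hv hc
    rw [splitTerm, clsOrZero_of_pos n hadm (Γ.connected.expand v), d_cls]
    simp only [dGen]
    rw [Fin.sum_univ_succ, contract_newEdge_term n Γ ν ω v hv]
    simp only [contract_oldEdge_term n Γ ν ω v hv, Fin.val_succ, pow_succ, mul_neg_one, neg_smul,
      Finset.sum_neg_distrib]
    simp
  · have hchi := WGraph.admissible_iff.1 Γ.admissible v
    obtain ⟨hw, h₀, hiff, hh⟩ := Γ.connected.exists_leaf h2 hv hchi hc
    obtain ⟨i, hi⟩ := ν.surjective ⟨_, h₀, hh, rfl⟩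
    have hmem : h₀ ∈ (ν i).1 := by rw [hi]; exact Or.inl rfl
    rw [splitTerm_of_chi_le n ν ω hv hc, map_zero, zero_add, Finset.sum_eq_single i]
    · rw [splitTerm_contract_of_leaf n Γ ν ω v i h₀ hmem hiff hw, smul_smul, ← mul_pow]
      simp
    · intro j _ hj
      -- The edge `ν j` does not meet `v`, so that `v` remains univalent of weight `1`.
      have hnot : h₀ ∉ (ν j).1 := fun H => hj (ν.injective (WGraph.edge_eq H hmem))
      have hfib : ∀ b, Γ.proj (ν j) b = Γ.proj (ν j) v ↔ b = v := by
        intro b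
        rw [WGraph.mk_eq_iff]
        refine or_iff_left ?_
        rintro ⟨h, hh, -, h1⟩
        rw [hiff] at h1
        exact hnot (h1 ▸ (Γ.inv_mem_edge (ν j) h).2 hh)
      rw [splitTerm_of_chi_le, smul_zero]
      · exact hv.trans_le (WGraph.wt_le_wt_proj _ _)
      · classical
        rw [WGraph.chi_contract, Finset.sum_congr (s₂ := {v}) (by ext; simp [hfib]) fun _ _ => rfl,
          Finset.sum_singleton]
        exact hc
    · exact fun H => absurd (Finset.mem_univ i) H

/-- Up to graphs of higher total weight, the commutator of the differential and the splitting
operator is multiplication by the total weight. The error consists of the graphs in which a loop is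
contracted. -/
lemma homotopy_cls (A : OrientedGraph S) (h2 : 2 ≤ ∑ u, A.graph.chi u) {q m : ℤ}
    (hq : A.graph.degInt n = q) (hm : A.graph.degInt n + A.numEdges = m) :
    d n (split n (cls n A)) + split n (d n (cls n A)) - (A.graph.totalWt : ℚ) • cls n A ∈
      weightFiltration n S q m (A.graph.totalWt + 1) := by
  classical
  obtain ⟨Γ, k, ν, ω⟩ := A
  simp only at h2 hq hm ⊢
  have hW : ∀ y : GE n S, (Γ.totalWt : ℚ) • y = ∑ v, (Γ.wt v : ℚ) • y := fun y => by
    rw [WGraph.totalWt, Nat.cast_sum, Finset.sum_smul]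
  have hterm : ∀ (v : Γ.V) (x y : GE n S), (0 < Γ.wt v → x = y) →
      (Γ.wt v : ℚ) • x = (Γ.wt v : ℚ) • y := by
    intro v x y h
    rcases Nat.eq_zero_or_pos (Γ.wt v) with h0 | h0
    · simp [h0]
    · rw [h h0]
  rw [split_cls, d_cls, splitGen, map_sum]
  simp only [map_smul]
  cases k with
  | zero =>
    simp only [dGen, map_zero, add_zero]
    rw [hW, Finset.sum_congr rfl fun v _ =>
      hterm v _ _ fun hv => d_splitTerm_of_noEdges n Γ ν ω v hv h2, sub_self]
    exact Submodule.zero_mem _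
  | succ k =>
    set T : ∀ i : Fin (k + 1), (Γ.toWGraph.contract (ν i)).V → GE n S := fun i =>
      splitTerm n (Γ.toWGraph.contract (ν i)) (Γ.contractOrder ν i)
        (ω.trans (Γ.legContract (ν i))) with hT
    set L : Fin (k + 1) → GE n S := fun i => ∑ x,
      (if Γ.IsLoop (ν i) ∧ ∃ h ∈ (ν i).1, Γ.proj (ν i) (Γ.bd h) = x then (1 : ℚ) else 0) • T i x
      with hL
    -- Expand the weights of the vertices of `Γ/e`: they are sums over the preimages in `Γ`, except
    -- for the unit of weight which a loop contributes.
    have hsplit : ∀ i, split n (cls n (contractTerm Γ ν ω i)) =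
        ∑ v, (Γ.wt v : ℚ) • T i (Γ.proj (ν i) v) + L i := by
      intro i
      rw [split_cls]
      change ∑ x : (Γ.toWGraph.contract (ν i)).V,
        ((Γ.toWGraph.contract (ν i)).wt x : ℚ) • T i x = _
      simp_rw [WGraph.contract_wt]
      push_cast
      simp only [add_smul]
      rw [Finset.sum_add_distrib]
      congr 1
      rw [← Finset.sum_fiberwise Finset.univ (Γ.proj (ν i))]
      refine Finset.sum_congr rfl fun x _ => ?_
      rw [Finset.sum_smul]
      refine Finset.sum_congr rfl fun v hv => ?_
      rw [(Finset.mem_filter.1 hv).2]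
    -- The sums over the preimages combine with the terms of `d (split A)` to the total weight.
    have hsum : ∑ v, (Γ.wt v : ℚ) • d n (splitTerm n Γ.toWGraph ν ω v) +
        split n (dGen n ⟨Γ, k + 1, ν, ω⟩) - (Γ.totalWt : ℚ) • cls n ⟨Γ, k + 1, ν, ω⟩ =
        ∑ i : Fin (k + 1), (-1 : ℚ) ^ (i : ℕ) • L i := by
      simp only [dGen, map_sum, map_smul, hsplit, smul_add, Finset.sum_add_distrib]
      rw [hW, ← add_assoc, add_sub_right_comm, add_eq_right, sub_eq_zero]
      simp only [Finset.smul_sum]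
      rw [Finset.sum_comm, ← Finset.sum_add_distrib]
      refine Finset.sum_congr rfl fun v _ => ?_
      rw [← hterm v _ _ fun hv => d_splitTerm n Γ ν ω v hv h2, smul_add, Finset.smul_sum]
      congr 1
      exact Finset.sum_congr rfl fun i _ => smul_comm _ _ _
    rw [hsum]
    refine Submodule.sum_mem _ fun i _ => Submodule.smul_mem _ _ ?_
    refine Submodule.sum_mem _ fun x _ => ?_
    split_ifs with hx
    · have hwt : (Γ.toWGraph.contract (ν i)).wt x ≠ 0 := by
        rw [WGraph.contract_wt, if_pos hx]
        omega
      have htot : Γ.totalWt + 1 ≤ (Γ.toWGraph.contract (ν i)).totalWt := by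
        rw [WGraph.totalWt_contract]
        refine Nat.add_le_add_left ?_ _
        refine le_trans ?_ (Finset.single_le_sum (fun _ _ => Nat.zero_le _) (Finset.mem_univ x))
        rw [if_pos hx]
      refine smul_splitTerm_mem n _ _ _ x (m' := q + k) ?_ rfl ?_ htot _ fun h => absurd h hwt
      · rw [WGraph.sum_chi_contract]
        exact hq
      · rw [← hm, hq]
        push_cast
        ring
    · rw [zero_smul]
      exact Submodule.zero_mem _

end GE

namespace BlackGraph

variable {S : Type u} (Γ : BlackGraph S)

lemma one_le_sum_chi : 1 ≤ ∑ v, Γ.chi v := by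
  obtain ⟨v⟩ := Γ.connected.1
  have h := WGraph.admissible_iff.1 Γ.admissible
  exact (h v).trans (Finset.single_le_sum (f := Γ.chi)
    (fun u _ => zero_le_one.trans (h u)) (Finset.mem_univ v))

lemma two_mul_totalWt_le {n : ℕ} (hn : 0 < n) : 2 * (Γ.totalWt : ℤ) ≤ 3 * Γ.degInt n := by
  have h1 : 2 * (Γ.totalWt : ℤ) ≤ 3 * ∑ v, Γ.chi v := by
    rw [WGraph.totalWt, Nat.cast_sum, Finset.mul_sum, Finset.mul_sum]
    refine Finset.sum_le_sum fun v _ => ?_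
    have h := WGraph.admissible_iff.1 Γ.admissible v
    unfold WGraph.chi at h ⊢
    omega
  have h2 := Γ.one_le_sum_chi
  have h3 : ∑ v, Γ.chi v ≤ Γ.degInt n := by
    unfold degInt
    exact le_mul_of_one_le_left (by omega) (by exact_mod_cast hn)
  omega

lemma two_le_sum_chi {n : ℕ} (h : Γ.degInt n ≠ n) : 2 ≤ ∑ v, Γ.chi v := by
  have h1 := Γ.one_le_sum_chi
  rcases h1.lt_or_eq with h1 | h1
  · exact h1
  · refine absurd ?_ h
    rw [degInt, ← h1, mul_one]

/-- The only graph of internal degree `n` and of positive weight is a vertex of weight `1` with one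
leg. -/
lemma exists_unique_vertex {n : ℕ} (hn : 0 < n) (h : Γ.degInt n = n) (hW : 1 ≤ Γ.totalWt) :
    ∃ v, (∀ u, u = v) ∧ Γ.wt v = 1 ∧ ∃ k, ∀ l : Γ.H, l = k := by
  classical
  have hn' : (n : ℤ) ≠ 0 := by exact_mod_cast hn.ne'
  have hsum : ∑ v, Γ.chi v = 1 := by
    unfold degInt at h
    exact mul_left_cancel₀ hn' (by rw [h, mul_one])
  have hchi := WGraph.admissible_iff.1 Γ.admissible
  obtain ⟨v, -, hv⟩ : ∃ v ∈ Finset.univ, Γ.wt v ≠ 0 :=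
    Finset.exists_ne_zero_of_sum_ne_zero (by unfold WGraph.totalWt at hW; omega)
  have huniq : ∀ u, u = v := by
    intro u
    by_contra hne
    have := Finset.sum_le_sum_of_subset_of_nonneg (f := Γ.chi) (Finset.subset_univ {u, v})
      fun w _ _ => zero_le_one.trans (hchi w)
    rw [Finset.sum_pair hne, hsum] at this
    have h1 := hchi u
    have h2 := hchi v
    omega
  have hv1 : Γ.chi v = 1 := by
    rw [← hsum, Finset.sum_congr (s₂ := {v}) (by ext u; simp [huniq u]) fun _ _ => rfl,
      Finset.sum_singleton]
  have h3 : 2 * Γ.wt v + Γ.val v = 3 := by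
    unfold WGraph.chi at hv1
    omega
  have hval : Γ.wt v = 1 → Γ.val v = 1 := by omega
  have hwt : Γ.wt v = 1 := by omega
  obtain ⟨k, hk⟩ := Finset.card_eq_one.1 (hval hwt)
  exact ⟨v, huniq, hwt, k, fun l => by simpa [huniq (Γ.bd l)] using Finset.ext_iff.1 hk l⟩

end BlackGraph

/-! ### Acyclicity of the graphs of positive weight -/

namespace GE

variable {S : Type u} (n : ℕ)

lemma weightFiltration_anti {q m : ℤ} {i j : ℕ} (h : i ≤ j) :
    weightFiltration n S q m j ≤ weightFiltration n S q m i :=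
  Submodule.span_mono fun _ ⟨A, h1, h2, h3, h4⟩ => ⟨A, h1, h2, h.trans h3, h4⟩

lemma weightFiltration_le_piece {q m : ℤ} {j : ℕ} :
    weightFiltration n S q m j ≤ piece n S q m :=
  Submodule.span_mono fun _ ⟨A, h1, h2, _, h4⟩ => ⟨A, h1, h2, h4⟩

lemma weightFiltration_le_positive {q m : ℤ} :
    weightFiltration n S q m 1 ≤ positive n S :=
  Submodule.span_mono fun _ ⟨A, _, _, h3, h4⟩ => ⟨A, by
    by_contra! H
    have : A.graph.totalWt = 0 := Finset.sum_eq_zero fun v _ => Nat.le_zero.1 (H v)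
    omega, h4⟩

open Classical in
/-- The projection of `G^{E_n}(S)` onto its part of internal degree `q` and total degree `m`. -/
noncomputable def degreeProj (q m : ℤ) : GE n S →ₗ[ℚ] GE n S :=
  lift n (fun A => if A.graph.degInt n = q ∧ A.graph.degInt n + A.numEdges = m
      then cls n A else 0)
    (fun Γ Γ' φ k ν ω => by
      have h : Γ'.degInt n = Γ.degInt n := congrArg (fun x => (n : ℤ) * x) φ.sum_chi
      simp only [h]
      split_ifs
      · exact cls_iso n φ (fun i h => (φ.mem_edgeEquiv (ν i) h).symm) fun _ => rfl
      · rfl)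
    (fun Γ k ν ω σ => by
      simp only
      split_ifs
      · exact cls_edges n Γ k ν ω σ
      · rw [smul_zero])
    (fun Γ k ν ω τ => by
      simp only
      split_ifs
      · exact cls_legs n Γ k ν ω τ
      · rw [smul_zero])

lemma degreeProj_of_mem {q m : ℤ} {x : GE n S} (hx : x ∈ piece n S q m) :
    degreeProj n q m x = x := by
  induction hx using Submodule.span_induction with
  | mem x hx =>
    obtain ⟨A, h1, h2, rfl⟩ := hx
    rw [degreeProj, lift_cls, if_pos ⟨h1, h2⟩]
  | zero => rw [map_zero]
  | add x y _ _ hx hy => rw [map_add, hx, hy]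
  | smul c x _ hx => rw [map_smul, hx]

lemma mem_weightFiltration_one {q m : ℤ} {x : GE n S} (hx : x ∈ piece n S q m)
    (hpos : x ∈ positive n S) : x ∈ weightFiltration n S q m 1 := by
  rw [← degreeProj_of_mem n hx]
  clear hx
  induction hpos using Submodule.span_induction with
  | mem x hx =>
    obtain ⟨A, ⟨v, hv⟩, rfl⟩ := hx
    rw [degreeProj, lift_cls]
    split_ifs with h
    · exact Submodule.subset_span ⟨A, h.1, h.2, hv.trans_le (Finset.single_le_sum
        (f := A.graph.wt) (fun _ _ => Nat.zero_le _) (Finset.mem_univ v)), rfl⟩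
    · exact Submodule.zero_mem _
  | zero => rw [map_zero]; exact Submodule.zero_mem _
  | add x y _ _ hx hy => rw [map_add]; exact Submodule.add_mem _ hx hy
  | smul c x _ hx => rw [map_smul]; exact Submodule.smul_mem _ _ hx

lemma weightFiltration_eq_bot (hn : 0 < n) {q m : ℤ} {j : ℕ} (h : 3 * q < 2 * j) :
    weightFiltration n S q m j = ⊥ := by
  rw [weightFiltration, Submodule.span_eq_bot]
  rintro x ⟨A, h1, -, h3, rfl⟩
  have := A.graph.two_mul_totalWt_le hn
  omega

lemma split_mem {q m m' : ℤ} (hm : m' + 1 = m) {j : ℕ} {x : GE n S}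
    (hx : x ∈ weightFiltration n S q m' j) : split n x ∈ weightFiltration n S q m j := by
  induction hx using Submodule.span_induction with
  | mem x hx =>
    obtain ⟨A, h1, h2, h3, rfl⟩ := hx
    rw [split_cls]
    exact Submodule.sum_mem _ fun v _ =>
      smul_splitTerm_mem n _ _ _ v h1 (by rw [← h2, h1]) hm h3 _ fun h => by rw [h, Nat.cast_zero]
  | zero => rw [map_zero]; exact Submodule.zero_mem _
  | add x y _ _ hx hy => rw [map_add]; exact Submodule.add_mem _ hx hy
  | smul c x _ hx => rw [map_smul]; exact Submodule.smul_mem _ _ hx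

lemma homotopy_mem {q m : ℤ} (hq : q ≠ n) {j : ℕ} {x : GE n S}
    (hx : x ∈ weightFiltration n S q m j) :
    d n (split n x) + split n (d n x) - (j : ℚ) • x ∈ weightFiltration n S q m (j + 1) := by
  induction hx using Submodule.span_induction with
  | mem x hx =>
    obtain ⟨A, h1, h2, h3, rfl⟩ := hx
    have h := homotopy_cls n A (A.graph.two_le_sum_chi (n := n) (h1 ▸ hq)) h1 h2
    have h' : ((A.graph.totalWt : ℚ) - j) • cls n A ∈ weightFiltration n S q m (j + 1) := by
      rcases h3.eq_or_lt with h3 | h3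
      · rw [← h3, sub_self, zero_smul]
        exact Submodule.zero_mem _
      · exact Submodule.smul_mem _ _ (Submodule.subset_span ⟨A, h1, h2, h3, rfl⟩)
    have := Submodule.add_mem _ (weightFiltration_anti n (Nat.succ_le_succ h3) h) h'
    rwa [sub_smul, sub_add_sub_cancel] at this
  | zero => simp
  | add x y _ _ hx hy =>
    convert Submodule.add_mem _ hx hy using 1
    simp only [map_add, smul_add]
    abel
  | smul c x _ hx =>
    convert Submodule.smul_mem _ c hx using 1
    simp only [map_smul, smul_sub, smul_add, smul_comm c]

/-- Away from internal degree `n`, the complex spanned by the graphs of positive weight is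
acyclic, and so is every step of its filtration by the total weight: a cycle `x` of total weight at
least `j` agrees with the boundary of `j⁻¹ • split x` up to a cycle of total weight at least
`j + 1`, and the total weight is bounded. -/
lemma exists_d_eq (hn : 0 < n) {q m m' : ℤ} (hm : m + 1 = m') (hq : q ≠ n) {j : ℕ} (hj : 1 ≤ j)
    {x : GE n S} (hx : x ∈ weightFiltration n S q m j) (hdx : d n x = 0) :
    ∃ y ∈ weightFiltration n S q m' j, d n y = x := by
  obtain ⟨t, ht⟩ : ∃ t : ℕ, 3 * q < 2 * ((j + t : ℕ) : ℤ) := ⟨(3 * q).toNat + 1, by omega⟩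
  induction t generalizing j x with
  | zero =>
    rw [weightFiltration_eq_bot n hn (by simpa using ht), Submodule.mem_bot] at hx
    exact ⟨0, Submodule.zero_mem _, by rw [map_zero, hx]⟩
  | succ t ih =>
    have h1 := homotopy_mem n hq hx
    rw [hdx, map_zero, add_zero] at h1
    obtain ⟨z, hz, hdz⟩ := ih (Nat.le_succ_of_le hj) h1
      (by rw [map_sub, d_d, map_smul, hdx, smul_zero, sub_zero])
      (by rwa [Nat.succ_add_eq_add_succ])
    have hj0 : (j : ℚ) ≠ 0 := by exact_mod_cast (Nat.pos_of_ne_zero (by omega)).ne'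
    refine ⟨(j : ℚ)⁻¹ • (split n x - z), Submodule.smul_mem _ _ (Submodule.sub_mem _
      (split_mem n hm hx) (weightFiltration_anti n (Nat.le_succ j) hz)), ?_⟩
    rw [map_smul, map_sub, hdz, sub_sub_cancel, inv_smul_smul₀ hj0]

end GE

/-! ### Internal degree `n` -/

lemma WGraph.val_eq_one_of_unique {S : Type u} (Γ : WGraph S) {v : Γ.V} (hv : ∀ u, u = v)
    {k : Γ.H} (hk : ∀ l, l = k) : Γ.val v = 1 := by
  rw [val, Finset.card_eq_one]
  exact ⟨k, by ext l; simp [hk l, hv (Γ.bd k)]⟩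

/-- A vertex of weight `1` with one leg and no other half-edges. -/
structure OrientedGraph.IsPointed {S : Type u} (A : OrientedGraph S) : Prop where
  vertex : ∃ v, (∀ u, u = v) ∧ A.graph.wt v = 1
  halfEdge : ∃ k, ∀ l : A.graph.H, l = k

namespace OrientedGraph

variable {S : Type u} {A B : OrientedGraph S}

lemma isPointed {n : ℕ} (hn : 0 < n) (h : A.graph.degInt n = n) (hW : 1 ≤ A.graph.totalWt) :
    A.IsPointed := by
  obtain ⟨v, h1, h2, h3⟩ := A.graph.exists_unique_vertex hn h hW
  exact ⟨⟨v, h1, h2⟩, h3⟩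

lemma IsPointed.numEdges_eq (hA : A.IsPointed) : A.numEdges = 0 := by
  obtain ⟨k, hk⟩ := hA.halfEdge
  by_contra h
  obtain ⟨h, hh, -⟩ := (A.ν ⟨0, Nat.pos_of_ne_zero h⟩).2
  exact hh ((hk _).trans (hk _).symm)

lemma IsPointed.subsingleton (hA : A.IsPointed) : Subsingleton S := by
  obtain ⟨k, hk⟩ := hA.halfEdge
  have : Subsingleton A.graph.Leg :=
    ⟨fun a b => Subtype.ext ((hk _).trans (hk _).symm)⟩
  exact A.graph.label.symm.injective.subsingleton

lemma IsPointed.card_eq_one (hA : A.IsPointed) : Nat.card S = 1 := by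
  have := hA.subsingleton
  obtain ⟨k, hk⟩ := hA.halfEdge
  rw [Nat.card_eq_one_iff_unique]
  exact ⟨this, ⟨A.graph.label ⟨k, hk _⟩⟩⟩

lemma IsPointed.cls_eq (n : ℕ) (hA : A.IsPointed) (hB : B.IsPointed) :
    GE.cls n A = GE.cls n B := by
  have hS := hA.subsingleton
  have hA0 := hA.numEdges_eq
  have hB0 := hB.numEdges_eq
  obtain ⟨⟨a, ha, hwa⟩, k, hk⟩ := hA
  obtain ⟨⟨b, hb, hwb⟩, l, hl⟩ := hB
  obtain ⟨Γ, _, ν, ω⟩ := A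
  obtain ⟨Γ', _, ν', ω'⟩ := B
  subst hA0 hB0
  let φ : WGraph.Iso Γ'.toWGraph Γ.toWGraph :=
    { toV := ⟨fun _ => a, fun _ => b, fun _ => (hb _).symm, fun _ => (ha _).symm⟩
      toH := ⟨fun _ => k, fun _ => l, fun _ => (hl _).symm, fun _ => (hk _).symm⟩
      bd_comm := fun _ => (ha _).symm
      inv_comm := fun _ => (hk _).symm
      wt_comm := fun v => hwa.trans (by rw [hb v]; exact hwb.symm)
      label_comm := fun _ => Subsingleton.elim _ _ }
  exact GE.cls_iso n φ (fun i => i.elim0) fun _ => (hk _).symm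

lemma IsPointed.degInt_eq (hA : A.IsPointed) (n : ℕ) : A.graph.degInt n = n := by
  obtain ⟨⟨v, hv, hw⟩, k, hk⟩ := hA
  have hval := A.graph.val_eq_one_of_unique hv hk
  rw [BlackGraph.degInt, Finset.sum_congr (s₂ := {v}) (by ext u; simp [hv u]) fun _ _ => rfl,
    Finset.sum_singleton, WGraph.chi, hval, hw]
  norm_num

lemma IsPointed.totalWt_pos (hA : A.IsPointed) : 1 ≤ A.graph.totalWt := by
  obtain ⟨⟨v, -, hw⟩, -⟩ := hA
  rw [← hw]
  exact Finset.single_le_sum (f := A.graph.wt) (fun _ _ => Nat.zero_le _) (Finset.mem_univ v)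

lemma exists_isPointed (hS : Nat.card S = 1) : ∃ A : OrientedGraph S, A.IsPointed := by
  obtain ⟨hsub, ⟨s⟩⟩ := Nat.card_eq_one_iff_unique.1 hS
  have : Finite S := Finite.of_subsingleton
  let G : WGraph S :=
    { V := PUnit
      H := PUnit
      bd := id
      inv := id
      inv_inv := fun _ => rfl
      wt := fun _ => 1
      label := ⟨fun _ => s, fun _ => ⟨PUnit.unit, rfl⟩, fun _ => rfl,
        fun _ => Subsingleton.elim _ _⟩ }
  have hval : ∀ v, G.val v = 1 := fun v =>
    G.val_eq_one_of_unique (v := v) (fun _ => rfl) (k := PUnit.unit) fun _ => rfl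
  have hE : IsEmpty G.Edge := ⟨fun ⟨_, h, hh, _⟩ => hh rfl⟩
  let Γ : BlackGraph S :=
    { toWGraph := G
      admissible := fun v => by rw [hval]; exact le_refl 3
      connected := ⟨⟨PUnit.unit⟩, fun _ _ => .refl⟩ }
  exact ⟨⟨Γ, 0, Equiv.equivOfIsEmpty _ _, (Finite.equivFin S).symm.trans G.label.symm⟩,
    ⟨PUnit.unit, fun _ => rfl, rfl⟩, PUnit.unit, fun _ => rfl⟩

end OrientedGraph

namespace GE

variable {S : Type u} (n : ℕ)

lemma weightFiltration_eq_bot_of_ne (hn : 0 < n) {m : ℤ} (h : ¬ (Nat.card S = 1 ∧ m = n)) :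
    weightFiltration n S n m 1 = ⊥ := by
  rw [weightFiltration, Submodule.span_eq_bot]
  rintro x ⟨A, h1, h2, h3, rfl⟩
  have hA := A.isPointed hn h1 h3
  rw [h1, hA.numEdges_eq] at h2
  exact absurd ⟨hA.card_eq_one, by simpa using h2.symm⟩ h

lemma mem_weightFiltration_pointed (hn : 0 < n) {m : ℤ} {A : OrientedGraph S} (hA : A.IsPointed)
    {x : GE n S} (hx : x ∈ weightFiltration n S n m 1) : ∃ c : ℚ, x = c • cls n A := by
  have : weightFiltration n S n m 1 ≤ Submodule.span ℚ {cls n A} := by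
    refine Submodule.span_le.2 ?_
    rintro x ⟨B, h1, -, h3, rfl⟩
    rw [(B.isPointed hn h1 h3).cls_eq n hA]
    exact Submodule.mem_span_singleton_self _
  obtain ⟨c, rfl⟩ := Submodule.mem_span_singleton.1 (this hx)
  exact ⟨c, rfl⟩

open Classical in
/-- For a single leg, the functional which is `1` on the graphs without edges of internal degree `n`
and `0` on the other graphs. -/
noncomputable def pointFunctional (hS : Nat.card S = 1) : GE n S →ₗ[ℚ] ℚ :=
  lift n (fun A => if A.numEdges = 0 ∧ A.graph.degInt n = n then 1 else 0)
    (fun Γ Γ' φ k ν ω => by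
      have h : Γ'.degInt n = Γ.degInt n := congrArg (fun x => (n : ℤ) * x) φ.sum_chi
      simp only [h])
    (fun Γ k ν ω σ => by
      rcases Nat.eq_zero_or_pos k with rfl | hk
      · rw [Subsingleton.elim σ 1, Equiv.Perm.sign_one]
        simp
      · simp [hk.ne'])
    (fun Γ k ν ω τ => by
      have : Subsingleton (Fin (Nat.card S)) := by rw [hS]; infer_instance
      rw [Subsingleton.elim τ 1, Equiv.Perm.sign_one]
      simp)

lemma pointFunctional_cls (hS : Nat.card S = 1) {A : OrientedGraph S} (hA : A.IsPointed) :
    pointFunctional n hS (cls n A) = 1 := by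
  rw [pointFunctional, lift_cls, if_pos ⟨hA.numEdges_eq, hA.degInt_eq n⟩]

lemma pointFunctional_d_positive (hn : 0 < n) (hS : Nat.card S = 1) :
    positive n S ≤ LinearMap.ker (pointFunctional n hS ∘ₗ d n) := by
  refine Submodule.span_le.2 ?_
  rintro _ ⟨⟨Γ, k, ν, ω⟩, ⟨v, hv⟩, rfl⟩
  rw [SetLike.mem_coe, LinearMap.mem_ker, LinearMap.comp_apply, d_cls]
  cases k with
  | zero => exact map_zero _
  | succ k =>
    have hdeg : Γ.degInt n ≠ n := fun H => by
      have := (OrientedGraph.isPointed (A := ⟨Γ, k + 1, ν, ω⟩) hn H (hv.trans_le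
        (Finset.single_le_sum (f := Γ.wt) (fun _ _ => Nat.zero_le _)
          (Finset.mem_univ v)))).numEdges_eq
      simp at this
    simp only [dGen, map_sum, map_smul]
    refine Finset.sum_eq_zero fun i _ => ?_
    have h : (contractTerm Γ ν ω i).graph.degInt n = Γ.degInt n :=
      congrArg (fun x => (n : ℤ) * x) (Γ.sum_chi_contract (ν i))
    rw [pointFunctional, lift_cls, if_neg (by rw [h]; exact fun H => hdeg H.2), smul_zero]

end GE

/-! ### The homology of a mapping cone of modules -/

namespace ConeHomology

open CategoryTheory

/-- A criterion for the homology of a short complex of vector spaces to be one-dimensional. -/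
lemma nonempty_homology_equiv (T : ShortComplex (ModuleCat.{v} ℚ)) (Ψ : T.X₂ →ₗ[ℚ] ℚ)
    (hΨ : ∀ x, Ψ (T.f x) = 0) (hker : ∀ z, T.g z = 0 → Ψ z = 0 → ∃ x, T.f x = z)
    (hsurj : ∃ z, T.g z = 0 ∧ Ψ z = 1) : Nonempty (T.homology ≃ₗ[ℚ] ℚ) := by
  let Φ : LinearMap.ker T.g.hom →ₗ[ℚ] ℚ := Ψ ∘ₗ (LinearMap.ker T.g.hom).subtype
  have hΦ : Function.Surjective Φ := by
    obtain ⟨z, hz, hz'⟩ := hsurj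
    intro c
    refine ⟨c • ⟨z, hz⟩, ?_⟩
    rw [map_smul]
    change c • Ψ z = c
    rw [hz', smul_eq_mul, mul_one]
  have hr : LinearMap.range T.moduleCatToCycles = LinearMap.ker Φ := by
    ext ⟨z, hz⟩
    constructor
    · rintro ⟨x, hx⟩
      have : T.f x = z := congrArg Subtype.val hx
      subst this
      exact hΨ x
    · intro h
      obtain ⟨x, rfl⟩ := hker z hz h
      exact ⟨x, rfl⟩
  exact ⟨T.moduleCatHomologyIso.toLinearEquiv.trans
    ((Submodule.quotEquivOfEq _ _ hr).trans (Φ.quotKerEquivOfSurjective hΦ))⟩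

open HomologicalComplex homotopyCofiber

variable {F G : ChainComplex (ModuleCat.{v} ℚ) ℤ} (φ : F ⟶ G)

/-- The module in degree `i` of the mapping cone. -/
noncomputable abbrev coneX (i : ℤ) : ModuleCat.{v} ℚ := homotopyCofiber.X φ i

/-- The homology of the mapping cone is computed by the short complex in three consecutive
degrees. -/
noncomputable def homologyIso (m : ℤ) : (homotopyCofiber φ).homology m ≅
    ((homotopyCofiber φ).sc' (m + 1) m (m - 1)).homology :=
  (homotopyCofiber φ).homologyIsoSc' (m + 1) m (m - 1)
    ((ComplexShape.down ℤ).prev_eq' rfl) ((ComplexShape.down ℤ).next_eq' (sub_add_cancel m 1))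

section elements

variable {i j : ℤ} (h : (ComplexShape.down ℤ).Rel i j)

lemma fst_inl (a : F.X j) : fstX φ i j h (inlX φ j i h a) = a :=
  congrArg (fun f => f.hom a) (inlX_fstX φ j i h)

lemma snd_inl (a : F.X j) : sndX φ i (inlX φ j i h a) = 0 :=
  congrArg (fun f => f.hom a) (inlX_sndX φ j i h)

lemma ext_elements (h : (ComplexShape.down ℤ).Rel i j) {z z' : coneX φ i}
    (h1 : fstX φ i j h z = fstX φ i j h z') (h2 : sndX φ i z = sndX φ i z') : z = z' := by
  have key : 𝟙 (coneX φ i) = fstX φ i j h ≫ inlX φ j i h + sndX φ i ≫ inrX φ i := by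
    apply ext_to_X φ i j h <;> simp
  have key' : ∀ z : coneX φ i, z = inlX φ j i h (fstX φ i j h z) + inrX φ i (sndX φ i z) := fun z =>
    congrArg (fun f => f.hom z) key
  rw [key' z, key' z', h1, h2]

lemma fst_d {k : ℤ} (h' : (ComplexShape.down ℤ).Rel j k) (z : coneX φ i) :
    fstX φ j k h' (homotopyCofiber.d φ i j z) = -F.d j k (fstX φ i j h z) :=
  congrArg (fun f => f.hom z) (d_fstX φ i j k h h')

lemma snd_d (z : coneX φ i) :
    sndX φ j (homotopyCofiber.d φ i j z) = φ.f j (fstX φ i j h z) + G.d i j (sndX φ i z) :=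
  congrArg (fun f => f.hom z) (d_sndX φ i j h)

end elements

end ConeHomology

/-! ### The relative homology -/

section

open CategoryTheory HomologicalComplex ConeHomology

variable {n : ℕ} {S : Type u} {q : ℤ}

lemma complexGE_d_coe {m m' : ℤ} (h : m' + 1 = m) (x : (complexGE n S q).X m) :
    ((complexGE n S q).d m m' x).1 = GE.d n x.1 := by
  simp only [complexGE, dif_pos h]
  rfl

lemma complexGZ_d_coe {m m' : ℤ} (h : m' + 1 = m) (x : (complexGZ n S q).X m) :
    ((complexGZ n S q).d m m' x).1 = GZ.d n x.1 := by
  simp only [complexGZ, dif_pos h]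
  rfl

lemma down_rel (m : ℤ) : (ComplexShape.down ℤ).Rel m (m - 1) := sub_add_cancel m 1

/-- The component of an element of the mapping cone in `G^{E_n}(S)`. -/
noncomputable def coneFst (m : ℤ) (z : coneX (quotientMap n S q) m) : GE n S :=
  (homotopyCofiber.fstX (quotientMap n S q) m (m - 1) (down_rel m) z).1

/-- The component of an element of the mapping cone in `G^{Z_n}(S)`. -/
noncomputable def coneSnd (m : ℤ) (z : coneX (quotientMap n S q) m) : GZ n S :=
  (homotopyCofiber.sndX (quotientMap n S q) m z).1

lemma coneFst_zero {m : ℤ} : coneFst m (0 : coneX (quotientMap n S q) m) = 0 := by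
  rw [coneFst, map_zero]
  rfl

lemma coneSnd_zero {m : ℤ} : coneSnd m (0 : coneX (quotientMap n S q) m) = 0 := by
  rw [coneSnd, map_zero]
  rfl

lemma coneFst_d {m : ℤ} (z : coneX (quotientMap n S q) m) :
    coneFst (m - 1) (homotopyCofiber.d (quotientMap n S q) m (m - 1) z) =
      -GE.d n (coneFst m z) := by
  rw [coneFst, fst_d _ (down_rel m) (down_rel (m - 1))]
  exact congrArg Neg.neg (complexGE_d_coe (down_rel (m - 1)) _)

lemma coneSnd_d {m : ℤ} (z : coneX (quotientMap n S q) m) :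
    coneSnd (m - 1) (homotopyCofiber.d (quotientMap n S q) m (m - 1) z) =
      (GE.positive n S).mkQ (coneFst m z) + GZ.d n (coneSnd m z) := by
  rw [coneSnd, snd_d _ (down_rel m)]
  exact congrArg _ (complexGZ_d_coe (down_rel m) _)

lemma cone_ext {m : ℤ} {z z' : coneX (quotientMap n S q) m}
    (h1 : coneFst m z = coneFst m z') (h2 : coneSnd m z = coneSnd m z') : z = z' :=
  ext_elements _ (down_rel m) (Subtype.ext h1) (Subtype.ext h2)

lemma exists_cone_fst {m : ℤ} {a : GE n S} (ha : a ∈ GE.piece n S q (m - 1)) :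
    ∃ z : coneX (quotientMap n S q) m, coneFst m z = a ∧ coneSnd m z = 0 :=
  ⟨homotopyCofiber.inlX (quotientMap n S q) (m - 1) m (down_rel m) ⟨a, ha⟩,
    congrArg Subtype.val (fst_inl (quotientMap n S q) (down_rel m) ⟨a, ha⟩),
    congrArg Subtype.val (snd_inl (quotientMap n S q) (down_rel m) ⟨a, ha⟩)⟩

/-- A cycle of the mapping cone differs by the boundary of an element of `G^{E_n}(S)` from a cycle
spanned by graphs of positive weight. -/
lemma exists_of_cone_cycle {m : ℤ} (z : coneX (quotientMap n S q) m)
    (hz : homotopyCofiber.d (quotientMap n S q) m (m - 1) z = 0) :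
    ∃ a ∈ GE.weightFiltration n S q (m - 1) 1, ∃ b ∈ GE.piece n S q m, GE.d n a = 0 ∧
      coneFst m z = a - GE.d n b ∧ coneSnd m z = (GE.positive n S).mkQ b := by
  have h1 := coneFst_d z
  have h2 := coneSnd_d z
  rw [hz] at h1 h2
  have h1' : GE.d n (coneFst m z) = 0 := by
    rw [← neg_eq_zero, ← h1, coneFst_zero]
  have h2' : (GE.positive n S).mkQ (coneFst m z) + GZ.d n (coneSnd m z) = 0 := by
    rw [← h2, coneSnd_zero]
  have hsnd : coneSnd m z ∈ GZ.piece n S q m :=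
    (homotopyCofiber.sndX (quotientMap n S q) m z).2
  have hfst : coneFst m z ∈ GE.piece n S q (m - 1) :=
    (homotopyCofiber.fstX (quotientMap n S q) m (m - 1) (down_rel m) z).2
  obtain ⟨b, hb, hbz⟩ := hsnd
  refine ⟨coneFst m z + GE.d n b, GE.mem_weightFiltration_one n
    (Submodule.add_mem _ hfst (GE.d_piece n q (down_rel m) hb)) ?_, b, hb, ?_,
    (add_sub_cancel_right _ _).symm, hbz.symm⟩
  · rw [← (GE.positive n S).ker_mkQ, LinearMap.mem_ker, map_add, ← GZ.d_mk, hbz, h2']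
  · rw [map_add, h1', GE.d_d, add_zero]

/-- An element of the mapping cone whose component in `G^{E_n}(S)` bounds in the graphs of positive
weight, up to the boundary of a lift of its other component, is a boundary. -/
lemma exists_cone_d_eq {m : ℤ} (z : coneX (quotientMap n S q) m) {b c : GE n S}
    (hb : b ∈ GE.piece n S q m) (hc : c ∈ GE.weightFiltration n S q m 1)
    (h1 : coneFst m z = GE.d n c - GE.d n b)
    (h2 : coneSnd m z = (GE.positive n S).mkQ b) :
    ∃ y, homotopyCofiber.d (quotientMap n S q) (m + 1) m y = z := by
  obtain ⟨m', rfl⟩ : ∃ m', m = m' - 1 := ⟨m + 1, by ring⟩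
  rw [sub_add_cancel]
  obtain ⟨y, hy1, hy2⟩ := exists_cone_fst (m := m')
    (Submodule.sub_mem _ hb (GE.weightFiltration_le_piece n hc))
  refine ⟨y, cone_ext ?_ ?_⟩
  · rw [coneFst_d, hy1, h1, map_sub, neg_sub]
  · have hc0 : (GE.positive n S).mkQ c = 0 := by
      rw [← LinearMap.mem_ker, Submodule.ker_mkQ]
      exact GE.weightFiltration_le_positive n hc
    rw [coneSnd_d, hy1, hy2, h2, map_zero, add_zero, map_sub, hc0, sub_zero]

lemma subsingleton_relativeHomology (hn : 0 < n) {p : ℤ}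
    (h : ¬ (Nat.card S = 1 ∧ p = 1 ∧ q = n)) : Subsingleton (relativeHomology n S p q) := by
  set m := p + q with hm
  have hex : ((homotopyCofiber (quotientMap n S q)).sc' (m + 1) m (m - 1)).Exact := by
    rw [ShortComplex.moduleCat_exact_iff]
    intro z hz
    obtain ⟨a, ha, b, hb, hda, h1, h2⟩ := exists_of_cone_cycle z hz
    by_cases hq : q = n
    · subst hq
      rw [GE.weightFiltration_eq_bot_of_ne n hn
        fun H => h ⟨H.1, by have := H.2; omega, rfl⟩, Submodule.mem_bot] at ha
      subst ha
      exact exists_cone_d_eq z hb (Submodule.zero_mem _) (by rw [h1, map_zero]) h2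
    · obtain ⟨c, hc, rfl⟩ := GE.exists_d_eq n hn (sub_add_cancel m 1) hq le_rfl ha hda
      exact exists_cone_d_eq z hb hc h1 h2
  have := (ShortComplex.exact_iff_isZero_homology _).1 hex
  exact ModuleCat.subsingleton_of_isZero (this.of_iso (homologyIso (quotientMap n S q) m))

/-- The functional on the mapping cone which detects the class of the vertex of weight one with one
leg. On `G^{Z_n}(S)` it sends the class of `x` to the value of `GE.pointFunctional` on the boundary of
`x` in `G^{E_n}(S)`; this correction makes it vanish on boundaries. -/
noncomputable def coneFunctional (hn : 0 < n) (hS : Nat.card S = 1) (m : ℤ) :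
    coneX (quotientMap n S q) m →ₗ[ℚ] ℚ :=
  GE.pointFunctional n hS ∘ₗ (GE.piece n S q (m - 1)).subtype ∘ₗ
      (homotopyCofiber.fstX (quotientMap n S q) m (m - 1) (down_rel m)).hom +
    (GE.positive n S).liftQ _ (GE.pointFunctional_d_positive n hn hS) ∘ₗ
      (GZ.piece n S q m).subtype ∘ₗ (homotopyCofiber.sndX (quotientMap n S q) m).hom

lemma coneFunctional_apply (hn : 0 < n) (hS : Nat.card S = 1) {m : ℤ}
    (z : coneX (quotientMap n S q) m) :
    coneFunctional hn hS m z = GE.pointFunctional n hS (coneFst m z) +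
      (GE.positive n S).liftQ _ (GE.pointFunctional_d_positive n hn hS) (coneSnd m z) := rfl

lemma coneFunctional_d (hn : 0 < n) (hS : Nat.card S = 1) {m m' : ℤ} (h : m' + 1 = m)
    (z : coneX (quotientMap n S q) m) :
    coneFunctional hn hS m' (homotopyCofiber.d (quotientMap n S q) m m' z) = 0 := by
  obtain rfl : m' = m - 1 := eq_sub_of_add_eq h
  obtain ⟨y, hy⟩ := (GE.positive n S).mkQ_surjective (coneSnd m z)
  rw [coneFunctional_apply, coneFst_d, coneSnd_d, ← hy, GZ.d_mk, map_add, Submodule.mkQ_apply,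
    Submodule.mkQ_apply, Submodule.liftQ_apply, Submodule.liftQ_apply, LinearMap.comp_apply,
    LinearMap.comp_apply, GE.d_d, map_neg, map_zero, add_zero, neg_add_cancel]

lemma nonempty_relativeHomology_equiv (hn : 0 < n) (hS : Nat.card S = 1) :
    Nonempty (relativeHomology n S 1 n ≃ₗ[ℚ] ℚ) := by
  set m : ℤ := 1 + n with hm
  obtain ⟨A, hA⟩ := OrientedGraph.exists_isPointed hS
  obtain ⟨e⟩ := nonempty_homology_equiv
    ((homotopyCofiber (quotientMap n S n)).sc' (m + 1) m (m - 1)) (coneFunctional hn hS m)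
    (coneFunctional_d hn hS rfl)
    (by
      intro z hz hΨ
      obtain ⟨a, ha, b, hb, hda, h1, h2⟩ := exists_of_cone_cycle z hz
      obtain ⟨c, rfl⟩ := GE.mem_weightFiltration_pointed n hn hA ha
      have hc : c = 0 := by
        have := (coneFunctional_apply hn hS z).symm.trans hΨ
        rw [h1, h2, Submodule.mkQ_apply, Submodule.liftQ_apply,
          LinearMap.comp_apply, map_sub, sub_add_cancel, map_smul,
          GE.pointFunctional_cls n hS hA, smul_eq_mul, mul_one] at this
        exact this
      subst hc
      exact exists_cone_d_eq z hb (Submodule.zero_mem _) (by rw [h1, map_zero, zero_smul]) h2)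
    (by
      have hmem : GE.cls n A ∈ GE.weightFiltration n S n (m - 1) 1 :=
        Submodule.subset_span ⟨A, hA.degInt_eq n, by
          rw [hA.degInt_eq n, hA.numEdges_eq, hm, Nat.cast_zero]; ring, hA.totalWt_pos, rfl⟩
      obtain ⟨z, hz1, hz2⟩ := exists_cone_fst (GE.weightFiltration_le_piece n hmem)
      have hd : GE.d n (GE.cls n A) = 0 := by
        have h0 := hA.numEdges_eq
        obtain ⟨Γ, k, ν, ω⟩ := A
        subst h0
        rw [GE.d_cls]
        rfl
      refine ⟨z, cone_ext ?_ ?_, ?_⟩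
      · refine (coneFst_d z).trans ?_
        rw [hz1, hd, neg_zero]
        exact coneFst_zero.symm
      · refine (coneSnd_d z).trans ?_
        have h0 : (GE.positive n S).mkQ (GE.cls n A) = 0 := by
          rw [← LinearMap.mem_ker, Submodule.ker_mkQ]
          exact GE.weightFiltration_le_positive n hmem
        rw [hz1, hz2, h0, map_zero, add_zero]
        exact coneSnd_zero.symm
      · refine (coneFunctional_apply hn hS z).trans ?_
        rw [hz1, hz2, GE.pointFunctional_cls n hS hA, map_zero, add_zero])
  exact ⟨(homologyIso (quotientMap n S n) m).toLinearEquiv.trans e⟩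

end

theorem mainTheorem10 (n : ℕ) (hn : 0 < n) (S : Type u) [Finite S] (p q : ℤ) :
    ((Nat.card S = 1 ∧ p = 1 ∧ q = n) → Nonempty (relativeHomology n S p q ≃ₗ[ℚ] ℚ)) ∧
    (¬ (Nat.card S = 1 ∧ p = 1 ∧ q = n) → Subsingleton (relativeHomology n S p q)) := by
  refine ⟨?_, subsingleton_relativeHomology hn⟩
  rintro ⟨hS, rfl, rfl⟩
  exact nonempty_relativeHomology_equiv hn hS
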